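/- **Conventions.** A commutative canonical hypergroup is a set $H$ with a commutative, associative hyperoperation $+$ taking two elements to a non-empty subset of $H$, with a neutral element $0$ ($0+x=\{x\}=x+0$), such that each $x$ has a unique $-x$ with $0\in x+(-x)$, and such that $x\in y+z$ implies $z\in x+(-y)$. Two such structures are isomorphic if there is a bijection carrying one hyperoperation onto the other. Let $\mathbf S=\{-1,0,1\}$ be the hyperfield of signs: the usual multiplication, and $0+s=\{s\}=s+0$, $1+1=\{1\}$, $(-1)+(-1)=\{-1\}$, $1+(-1)=(-1)+1=\{-1,0,1\}$. Let $\mathrm{Hom}(\mathbb Z[T],\mathbf S)$ be the set of maps $\varphi:\mathbb Z[T]\to\mathbf S$ with $\varphi(0)=0$, $\varphi(1)=1$, $\varphi(a+b)\in\varphi(a)+\varphi(b)$ and $\varphi(ab)=\varphi(a)\varphi(b)$. Extend such a $\varphi$ to $\mathbb Q[T]$ by $\varphi(p)=\varphi(np)$ for any integer $n>0$ with $np\in\mathbb Z[T]$, and put $$\mathrm{Re}(\varphi)=\sup\{a\in\mathbb Q:\varphi(T-a)=1\}\in[-\infty,\infty],$$ $$D_{\rm finite}(\mathbf S)=\{\varphi:\mathrm{Re}(\varphi)\in\mathbb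 R\},\qquad D^\times_{\rm finite}(\mathbf S)=\{\varphi\in D_{\rm finite}(\mathbf S):\mathrm{Re}(\varphi)\ne 0\}.$$ Let $\Delta^+,\Delta^\times:\mathbb Z[T]\to\mathbb Z[T]\otimes_{\mathbb Z}\mathbb Z[T]$ be the ring homomorphisms with $\Delta^+(T)=T\otimes1+1\otimes T$ and $\Delta^\times(T)=T\otimes T$. For $\Delta\in\{\Delta^+,\Delta^\times\}$, let $\varphi_1\star_\Delta\varphi_2$ be the set of all $\varphi\in\mathrm{Hom}(\mathbb Z[T],\mathbf S)$ such that $\varphi(x)\in\sum_i\varphi_1(a_i)\varphi_2(b_i)$ for every $x\in\mathbb Z[T]$ and every finite decomposition $\Delta(x)=\sum_i a_i\otimes b_i$. For an abelian group $A$ (written additively) and a subgroup $B\subset A$, let $A\times_{B^c}\mathbf S$ be the quotient of $A\times\mathbf S$ by the relation $(\alpha,s)\sim(\alpha,0)$ for $\alpha\notin B$, $s\in\mathbf S$. Its hyperoperation sends $(x,y)$ to the set of classes of all elements of $\xi+\eta$, where $\xi,\eta$ run through the representatives of $x,y$ and $(\alpha,s)+(\beta,t)=\{(\alpha+\beta,u):u\in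 s+t\}$ on $A\times\mathbf S$. Write $\mathbb R\times_{\bar{\mathbb Q}^c}\mathbf S$ for the case where $A$ is the additive group $\mathbb R$ and $B$ is the subgroup of real algebraic numbers, and $\mathbb R^\times\times_{\bar{\mathbb Q}^c}\mathbf S$ for the case where $A$ is the multiplicative group $\mathbb R^\times$ and $B$ is the subgroup of non-zero real algebraic numbers. **Theorem.** (1) The set $D_{\rm finite}(\mathbf S)$ is stable under $\star_{\Delta^+}$ and, with this hyperoperation, is a canonical hypergroup isomorphic to $\mathbb R\times_{\bar{\mathbb Q}^c}\mathbf S$. (2) The set $D^\times_{\rm finite}(\mathbf S)$ is stable under $\star_{\Delta^\times}$ and, with this hyperoperation, is a canonical hypergroup isomorphic to $\mathbb R^\times\times_{\bar{\mathbb Q}^c}\mathbf S$. -/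

import Mathlib

open scoped TensorProduct Polynomial

namespace HyperSign

/-- A hyperoperation `op` on `H` (with values in the subsets of `H`) makes `H` a commutative
canonical hypergroup with neutral element `e`. -/
structure IsCanonicalHypergroup {H : Type*} (op : H → H → Set H) (e : H) : Prop where
  nonempty : ∀ x y, (op x y).Nonempty
  comm : ∀ x y, op x y = op y x
  assoc : ∀ x y z, (⋃ w ∈ op x y, op w z) = ⋃ w ∈ op y z, op x w
  neutral_left : ∀ x, op e x = {x}
  neutral_right : ∀ x, op x e = {x}
  existsUnique_inv : ∀ x, ∃! y, e ∈ op x y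
  reversible : ∀ x y z y', x ∈ op y z → e ∈ op y y' → z ∈ op x y'

/-- The sets `H` and `K` with the given hyperoperations are isomorphic: some bijection carries
the hyperoperation of `H` onto that of `K`. (A neutral element is then carried to a neutral
element.) -/
def HyperIsomorphic {H K : Type*} (opH : H → H → Set H) (opK : K → K → Set K) : Prop :=
  ∃ f : H ≃ K, ∀ x y, f '' opH x y = opK (f x) (f y)

/-- A subset `S` is stable under a hyperoperation. -/
def IsStable {H : Type*} (op : H → H → Set H) (S : Set H) : Prop :=
  ∀ x ∈ S, ∀ y ∈ S, op x y ⊆ S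

/-- The hyperoperation induced on a subset. -/
def restrictOp {H : Type*} (op : H → H → Set H) (S : Set H) : S → S → Set S :=
  fun x y => {z | (z : H) ∈ op x y}

/-- Hyperrings. -/
class Hyperring (R : Type*) extends MonoidWithZero R, Nontrivial R where
  hadd : R → R → Set R
  isCanonicalHypergroup : IsCanonicalHypergroup hadd 0
  mul_hadd : ∀ r s t : R, (fun u => r * u) '' hadd s t = hadd (r * s) (r * t)
  hadd_mul : ∀ r s t : R, (fun u => u * r) '' hadd s t = hadd (s * r) (t * r)

/-- The (multivalued) sum of a finite list of elements of a hyperring. -/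
def hsum {R : Type*} [Hyperring R] : List R → Set R
  | [] => {0}
  | a :: l => ⋃ b ∈ hsum l, Hyperring.hadd a b

/-- The rule of signs. -/
def signAdd (s t : SignType) : Set SignType :=
  if s = 0 then {t} else if t = 0 then {s} else if s = t then {s} else Set.univ

theorem mem_signAdd (s t u : SignType) :
    u ∈ signAdd s t ↔ (s = 0 → u = t) ∧ (t = 0 → u = s) ∧ (s = t → u = s) := by
  unfold signAdd
  split_ifs <;> simp_all

instance instDecidableMemSignAdd (s t u : SignType) : Decidable (u ∈ signAdd s t) :=
  decidable_of_iff _ (mem_signAdd s t u).symm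

/-- The hyperfield of signs `𝐒 = {-1, 0, 1}`. -/
instance instHyperringSign : Hyperring SignType where
  hadd := signAdd
  isCanonicalHypergroup :=
    { nonempty := by simp only [Set.Nonempty]; decide
      comm := by simp only [Set.ext_iff]; decide
      assoc := by simp only [Set.ext_iff, Set.mem_iUnion, exists_prop]; decide
      neutral_left := by simp only [Set.ext_iff, Set.mem_singleton_iff]; decide
      neutral_right := by simp only [Set.ext_iff, Set.mem_singleton_iff]; decide
      existsUnique_inv := by simp only [ExistsUnique]; decide
      reversible := by decide }
  mul_hadd := by simp only [Set.ext_iff, Set.mem_image]; decide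
  hadd_mul := by simp only [Set.ext_iff, Set.mem_image]; decide

/-- (Unital) homomorphisms from a commutative ring to a hyperring. -/
structure HyperHom (A R : Type*) [CommRing A] [Hyperring R] where
  toFun : A → R
  map_zero : toFun 0 = 0
  map_one : toFun 1 = 1
  map_add : ∀ a b, toFun (a + b) ∈ Hyperring.hadd (toFun a) (toFun b)
  map_mul : ∀ a b, toFun (a * b) = toFun a * toFun b

instance {A R : Type*} [CommRing A] [Hyperring R] : CoeFun (HyperHom A R) (fun _ => A → R) :=
  ⟨HyperHom.toFun⟩

/-- `φ₁ ⋆_Δ φ₂`, for a coproduct `Δ` on `ℤ[T]`: the homomorphisms `φ` with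
`φ(x) ∈ ∑ φ₁(x₍₁₎) φ₂(x₍₂₎)` for all `x` and all decompositions `Δ(x) = ∑ x₍₁₎ ⊗ x₍₂₎` into
finitely many elementary tensors. -/
def star {R : Type*} [Hyperring R] (Δ : ℤ[X] →ₐ[ℤ] ℤ[X] ⊗[ℤ] ℤ[X])
    (φ₁ φ₂ : HyperHom ℤ[X] R) : Set (HyperHom ℤ[X] R) :=
  {φ | ∀ (x : ℤ[X]) (L : List (ℤ[X] × ℤ[X])),
    Δ x = (L.map fun p => p.1 ⊗ₜ[ℤ] p.2).sum →
      φ x ∈ hsum (L.map fun p => φ₁ p.1 * φ₂ p.2)}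

/-- The coproduct on `ℤ[T]` with `T ↦ T ⊗ 1 + 1 ⊗ T`. -/
noncomputable def deltaAdd : ℤ[X] →ₐ[ℤ] ℤ[X] ⊗[ℤ] ℤ[X] :=
  Polynomial.aeval ((Polynomial.X : ℤ[X]) ⊗ₜ[ℤ] (1 : ℤ[X]) + (1 : ℤ[X]) ⊗ₜ[ℤ] Polynomial.X)

/-- The coproduct on `ℤ[T]` with `T ↦ T ⊗ T`. -/
noncomputable def deltaMul : ℤ[X] →ₐ[ℤ] ℤ[X] ⊗[ℤ] ℤ[X] :=
  Polynomial.aeval ((Polynomial.X : ℤ[X]) ⊗ₜ[ℤ] (Polynomial.X : ℤ[X]))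

/-- The functions `𝒟(𝐒) = Hom(ℤ[T], 𝐒)`. -/
abbrev D : Type := HyperHom ℤ[X] SignType

/-- `Re φ = sup {a ∈ ℚ | φ(T - a) = 1} ∈ [-∞, ∞]`. Here `φ` is extended to `ℚ[T]` by
`φ(p) = φ(n p)` for any integer `n > 0` with `n p ∈ ℤ[T]`; for `p = T - a` the denominator of
`a` serves as `n`. -/
noncomputable def Re (φ : D) : EReal :=
  sSup {r : EReal | ∃ a : ℚ,
    φ (Polynomial.C (a.den : ℤ) * Polynomial.X - Polynomial.C a.num) = 1 ∧ r = ((a : ℝ) : EReal)}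

/-- The finite functions: `Re φ` is a real number. -/
def DFinite : Set D := {φ | ∃ r : ℝ, Re φ = (r : EReal)}

/-- The finite functions with `Re φ ≠ 0`. -/
def DFiniteNonzero : Set D := {φ | φ ∈ DFinite ∧ Re φ ≠ 0}

/-- The equivalence relation on `A × 𝐒` that forgets the sign over the complement of the
subgroup `B`. -/
def glueSetoid {A : Type*} [AddCommGroup A] (B : AddSubgroup A) : Setoid (A × SignType) where
  r x y := x.1 = y.1 ∧ (x.1 ∈ B → x.2 = y.2)
  iseqv :=
    { refl := fun _ => ⟨rfl, fun _ => rfl⟩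
      symm := fun h => ⟨h.1.symm, fun hy => (h.2 (h.1 ▸ hy)).symm⟩
      trans := fun h k => ⟨h.1.trans k.1, fun hx => (h.2 hx).trans (k.2 (h.1 ▸ hx))⟩ }

/-- The set `A ×_{Bᶜ} 𝐒`, a quotient of `A × 𝐒`. -/
def Glued {A : Type*} [AddCommGroup A] (B : AddSubgroup A) : Type _ := Quotient (glueSetoid B)

/-- The quotient map `A × 𝐒 → A ×_{Bᶜ} 𝐒`. -/
def Glued.mk {A : Type*} [AddCommGroup A] (B : AddSubgroup A) (x : A × SignType) : Glued B :=
  Quotient.mk (glueSetoid B) x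

/-- The product hyperaddition on `A × 𝐒`. -/
def prodSignAdd {A : Type*} [AddCommGroup A] (x y : A × SignType) : Set (A × SignType) :=
  {z | z.1 = x.1 + y.1 ∧ z.2 ∈ Hyperring.hadd x.2 y.2}

/-- The hyperaddition on `A ×_{Bᶜ} 𝐒`: the image of the hypersums of all representatives. -/
def gluedAdd {A : Type*} [AddCommGroup A] (B : AddSubgroup A) (x y : Glued B) : Set (Glued B) :=
  {z | ∃ ξ η ζ : A × SignType, Glued.mk B ξ = x ∧ Glued.mk B η = y ∧
    ζ ∈ prodSignAdd ξ η ∧ Glued.mk B ζ = z}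

/-- The real algebraic numbers as a subgroup of `(ℝ, +)`. -/
def realAlgebraic : AddSubgroup ℝ where
  carrier := {x | IsAlgebraic ℚ x}
  zero_mem' := isAlgebraic_zero
  add_mem' := fun hx hy => IsAlgebraic.add hx hy
  neg_mem' := fun hx => IsAlgebraic.neg hx

/-- The non-zero real algebraic numbers as a subgroup of `ℝˣ`. -/
def realAlgebraicUnits : Subgroup ℝˣ where
  carrier := {x | IsAlgebraic ℚ (x : ℝ)}
  one_mem' := by simpa using (isAlgebraic_one : IsAlgebraic ℚ (1 : ℝ))
  mul_mem' := fun hx hy => by simpa using IsAlgebraic.mul hx hy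
  inv_mem' := fun hx => by simpa using IsAlgebraic.inv hx

/-- The hyperaddition of `ℝ ×_{ℚ̄ᶜ} 𝐒`. -/
def realSignAdd : Glued realAlgebraic → Glued realAlgebraic → Set (Glued realAlgebraic) :=
  gluedAdd realAlgebraic

/-- The hyperoperation of `ℝˣ ×_{ℚ̄ᶜ} 𝐒`, where `ℝˣ` is the multiplicative group, written
additively. -/
def realUnitsSignAdd : Glued (Subgroup.toAddSubgroup realAlgebraicUnits) →
    Glued (Subgroup.toAddSubgroup realAlgebraicUnits) →
      Set (Glued (Subgroup.toAddSubgroup realAlgebraicUnits)) :=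
  gluedAdd (Subgroup.toAddSubgroup realAlgebraicUnits)

end HyperSign

namespace HyperSign

/-! ### The hypergroup `A ×_{Bᶜ} 𝐒` -/

section Glued

variable {A : Type*} [AddCommGroup A] {B : AddSubgroup A}

theorem Glued.mk_eq_mk {x y : A × SignType} :
    Glued.mk B x = Glued.mk B y ↔ x.1 = y.1 ∧ (x.1 ∈ B → x.2 = y.2) :=
  Quotient.eq (r := glueSetoid B)

theorem Glued.mk_surjective : Function.Surjective (Glued.mk B) := Quotient.mk_surjective

theorem signAdd_comm (s t : SignType) : signAdd s t = signAdd t s :=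
  Hyperring.isCanonicalHypergroup.comm s t

theorem exists_mem_signAdd (t u : SignType) : ∃ s, u ∈ signAdd s t := by
  revert t u; decide

theorem signAdd_assoc {s t r w v : SignType} (hw : w ∈ signAdd s t) (hv : v ∈ signAdd w r) :
    ∃ y, y ∈ signAdd t r ∧ v ∈ signAdd s y := by
  revert s t r w v; decide

theorem signAdd_reverse {s t u : SignType} (h : u ∈ signAdd s t) : t ∈ signAdd u (-s) := by
  revert s t u; decide

theorem zero_mem_signAdd {s t : SignType} (h : 0 ∈ signAdd s t) : t = -s := by
  revert s t; decide

theorem zero_mem_signAdd_neg (s : SignType) : 0 ∈ signAdd s (-s) := by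
  revert s; decide

theorem mem_prodSignAdd {x y z : A × SignType} :
    z ∈ prodSignAdd x y ↔ z.1 = x.1 + y.1 ∧ z.2 ∈ signAdd x.2 y.2 := Iff.rfl

theorem prodSignAdd_comm (x y : A × SignType) : prodSignAdd x y = prodSignAdd y x := by
  ext z
  rw [mem_prodSignAdd, mem_prodSignAdd, add_comm, signAdd_comm]

/-- If one of two classes lies over the complement of `B`, their hypersum is the whole fibre. -/
theorem exists_mem_prodSignAdd {α β : A} (h : ¬(α ∈ B ∧ β ∈ B)) (s t u : SignType) :
    ∃ s' t', Glued.mk B (α, s') = Glued.mk B (α, s) ∧ Glued.mk B (β, t') = Glued.mk B (β, t) ∧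
      (α + β, u) ∈ prodSignAdd (α, s') (β, t') := by
  by_cases hα : α ∈ B
  · obtain ⟨t', ht⟩ := exists_mem_signAdd s u
    exact ⟨s, t', rfl, Glued.mk_eq_mk.2 ⟨rfl, fun hβ => absurd ⟨hα, hβ⟩ h⟩, rfl,
      by rwa [signAdd_comm] at ht⟩
  · obtain ⟨s', hs⟩ := exists_mem_signAdd t u
    exact ⟨s', t, Glued.mk_eq_mk.2 ⟨rfl, fun hα' => absurd hα' hα⟩, rfl, rfl, hs⟩

theorem mk_mem_gluedAdd {x y : Glued B} {ζ : A × SignType} :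
    Glued.mk B ζ ∈ gluedAdd B x y ↔
      ∃ ξ η, Glued.mk B ξ = x ∧ Glued.mk B η = y ∧ ζ ∈ prodSignAdd ξ η := by
  constructor
  · rintro ⟨ξ, η, ω, rfl, rfl, hω, hωζ⟩
    obtain ⟨h1, h2⟩ := Glued.mk_eq_mk.1 hωζ
    by_cases hB : ξ.1 ∈ B ∧ η.1 ∈ B
    · have : ω = ζ := Prod.ext h1 (h2 (hω.1 ▸ B.add_mem hB.1 hB.2))
      exact ⟨ξ, η, rfl, rfl, this ▸ hω⟩
    · obtain ⟨s, t, hs, ht, h⟩ := exists_mem_prodSignAdd hB ξ.2 η.2 ζ.2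
      exact ⟨_, _, hs, ht, by rwa [← hω.1, h1] at h⟩
  · rintro ⟨ξ, η, hξ, hη, h⟩
    exact ⟨ξ, η, ζ, hξ, hη, h, rfl⟩

theorem gluedAdd_comm (x y : Glued B) : gluedAdd B x y = gluedAdd B y x := by
  ext z
  constructor <;>
  · rintro ⟨ξ, η, ζ, hξ, hη, h, hz⟩
    exact ⟨η, ξ, ζ, hη, hξ, prodSignAdd_comm ξ η ▸ h, hz⟩

theorem gluedAdd_assoc_subset (x y z : Glued B) :
    (⋃ w ∈ gluedAdd B x y, gluedAdd B w z) ⊆ ⋃ w ∈ gluedAdd B y z, gluedAdd B x w := by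
  intro v hv
  simp only [Set.mem_iUnion, exists_prop] at hv ⊢
  obtain ⟨w, hw, ω, ζ, υ, rfl, hζ, hυ, rfl⟩ := hv
  obtain ⟨ξ, η, hξ, hη, hω⟩ := mk_mem_gluedAdd.1 hw
  obtain ⟨r, hr, hr'⟩ := signAdd_assoc hω.2 hυ.2
  exact ⟨Glued.mk B (η.1 + ζ.1, r), ⟨η, ζ, _, hη, hζ, ⟨rfl, hr⟩, rfl⟩, ξ, _, υ, hξ, rfl,
    ⟨by rw [hυ.1, hω.1, add_assoc], hr'⟩, rfl⟩

theorem gluedAdd_zero_left (x : Glued B) : gluedAdd B (Glued.mk B (0, 0)) x = {x} := by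
  obtain ⟨ξ, rfl⟩ := Glued.mk_surjective x
  ext z
  obtain ⟨ζ, rfl⟩ := Glued.mk_surjective z
  rw [mk_mem_gluedAdd, Set.mem_singleton_iff]
  constructor
  · rintro ⟨⟨α, s⟩, η, h0, hη, h⟩
    obtain ⟨h1, h2⟩ := Glued.mk_eq_mk.1 h0
    obtain rfl : α = 0 := h1
    obtain rfl : s = 0 := h2 B.zero_mem
    rw [← hη, show ζ = η from Prod.ext (h.1.trans (zero_add _))
      (((mem_signAdd _ _ _).1 h.2).1 rfl)]
  · intro h
    exact ⟨(0, 0), ζ, rfl, h, (zero_add _).symm, (mem_signAdd _ _ _).2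
      ⟨fun _ => rfl, fun h => h, fun h => h.symm⟩⟩

theorem zero_mem_gluedAdd {η : A × SignType} {y : Glued B} :
    Glued.mk B (0, 0) ∈ gluedAdd B (Glued.mk B η) y ↔ y = Glued.mk B (-η.1, -η.2) := by
  rw [mk_mem_gluedAdd]
  constructor
  · rintro ⟨ξ, η', hξ, rfl, h⟩
    obtain ⟨h1, h2⟩ := Glued.mk_eq_mk.1 hξ
    have h3 : η'.1 = -ξ.1 := (neg_eq_of_add_eq_zero_right h.1.symm).symm
    refine Glued.mk_eq_mk.2 ⟨by rw [h3, h1], fun hB => ?_⟩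
    rw [h3, neg_mem_iff] at hB
    rw [zero_mem_signAdd h.2, h2 hB]
  · rintro rfl
    exact ⟨η, _, rfl, rfl, (add_neg_cancel _).symm, zero_mem_signAdd_neg _⟩

theorem isCanonicalHypergroup_gluedAdd :
    IsCanonicalHypergroup (gluedAdd B) (Glued.mk B (0, 0)) where
  nonempty x y := by
    obtain ⟨ξ, rfl⟩ := Glued.mk_surjective x
    obtain ⟨η, rfl⟩ := Glued.mk_surjective y
    obtain ⟨u, hu⟩ : (signAdd ξ.2 η.2).Nonempty := Hyperring.isCanonicalHypergroup.nonempty _ _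
    exact ⟨_, ξ, η, (ξ.1 + η.1, u), rfl, rfl, ⟨rfl, hu⟩, rfl⟩
  comm := gluedAdd_comm
  assoc x y z := by
    refine (gluedAdd_assoc_subset x y z).antisymm ?_
    simpa only [gluedAdd_comm (B := B)] using gluedAdd_assoc_subset z y x
  neutral_left := gluedAdd_zero_left
  neutral_right x := by rw [gluedAdd_comm, gluedAdd_zero_left]
  existsUnique_inv x := by
    obtain ⟨ξ, rfl⟩ := Glued.mk_surjective x
    exact ⟨_, zero_mem_gluedAdd.2 rfl, fun y hy => zero_mem_gluedAdd.1 hy⟩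
  reversible x y z y' hx hy := by
    obtain ⟨ξ, rfl⟩ := Glued.mk_surjective x
    obtain ⟨η, ζ, rfl, rfl, h⟩ := mk_mem_gluedAdd.1 hx
    obtain rfl := zero_mem_gluedAdd.1 hy
    exact mk_mem_gluedAdd.2 ⟨ξ, _, rfl, rfl, (eq_add_neg_of_add_eq ((add_comm _ _).trans h.1.symm)), signAdd_reverse h.2⟩

end Glued

/-! ### Transport of hypergroup structures -/

theorem IsCanonicalHypergroup.of_equiv {H K : Type*} {opH : H → H → Set H} {opK : K → K → Set K}
    {e : K} (h : IsCanonicalHypergroup opK e) (f : H ≃ K)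
    (hf : ∀ x y z, z ∈ opH x y ↔ f z ∈ opK (f x) (f y)) :
    IsCanonicalHypergroup opH (f.symm e) where
  nonempty x y := by
    obtain ⟨z, hz⟩ := h.nonempty (f x) (f y)
    exact ⟨f.symm z, by simpa [hf] using hz⟩
  comm x y := by ext z; rw [hf, hf, h.comm]
  assoc x y z := by
    ext v
    have := Set.ext_iff.1 (h.assoc (f x) (f y) (f z)) (f v)
    simp only [Set.mem_iUnion, exists_prop] at this ⊢
    simpa only [hf, f.surjective.exists] using this
  neutral_left x := by ext z; simp [hf, h.neutral_left]
  neutral_right x := by ext z; simp [hf, h.neutral_right]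
  existsUnique_inv x := by
    obtain ⟨y, hy, hu⟩ := h.existsUnique_inv (f x)
    refine ⟨f.symm y, by simpa [hf] using hy, fun w hw => ?_⟩
    rw [f.eq_symm_apply]
    exact hu _ (by simpa [hf] using hw)
  reversible x y z y' hx hy := by
    rw [hf] at hx hy ⊢
    exact h.reversible _ _ _ _ hx (by simpa using hy)

/-- A parametrization of a set with a hyperoperation by `A × 𝐒` that is compatible with the
gluing and with the hyperaddition identifies it with `A ×_{Bᶜ} 𝐒`. -/
theorem isCanonicalHypergroup_and_isomorphic_of_parametrization
    {A H : Type*} [AddCommGroup A] (B : AddSubgroup A) (op : H → H → Set H)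
    (g : A × SignType → H) (hg : Function.Surjective g)
    (heq : ∀ x y, g x = g y ↔ x.1 = y.1 ∧ (x.1 ∈ B → x.2 = y.2))
    (hadd : ∀ x y z, z ∈ prodSignAdd x y → g z ∈ op (g x) (g y))
    (hop : ∀ (α β : A) (s t : SignType), ∀ z ∈ op (g (α, s)) (g (β, t)),
      ∃ u, z = g (α + β, u) ∧ (α ∈ B → β ∈ B → u ∈ signAdd s t)) :
    (∃ e, IsCanonicalHypergroup op e) ∧ HyperIsomorphic op (gluedAdd B) := by
  have hlift : ∀ x y, (glueSetoid B).r x y → g x = g y := fun x y h => (heq x y).2 h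
  let F : Glued B → H := Quotient.lift g hlift
  have hF : ∀ x, F (Glued.mk B x) = g x := fun x => rfl
  have hbij : Function.Bijective F := by
    constructor
    · intro x y h
      obtain ⟨ξ, rfl⟩ := Glued.mk_surjective x
      obtain ⟨η, rfl⟩ := Glued.mk_surjective y
      exact Glued.mk_eq_mk.2 ((heq _ _).1 h)
    · intro x
      obtain ⟨ξ, rfl⟩ := hg x
      exact ⟨Glued.mk B ξ, rfl⟩
  let e := Equiv.ofBijective F hbij
  have key : ∀ x y z, F z ∈ op (F x) (F y) ↔ z ∈ gluedAdd B x y := by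
    intro x y z
    obtain ⟨⟨α, s⟩, rfl⟩ := Glued.mk_surjective x
    obtain ⟨⟨β, t⟩, rfl⟩ := Glued.mk_surjective y
    obtain ⟨ζ, rfl⟩ := Glued.mk_surjective z
    rw [mk_mem_gluedAdd]
    constructor
    · intro h
      obtain ⟨u, hu, hB⟩ := hop α β s t _ h
      have hu' : Glued.mk B ζ = Glued.mk B (α + β, u) := hbij.1 hu
      rw [← mk_mem_gluedAdd, hu', mk_mem_gluedAdd]
      by_cases hαβ : α ∈ B ∧ β ∈ B
      · exact ⟨_, _, rfl, rfl, rfl, hB hαβ.1 hαβ.2⟩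
      · obtain ⟨s', t', h1, h2, h3⟩ := exists_mem_prodSignAdd hαβ s t u
        exact ⟨_, _, h1, h2, h3⟩
    · rintro ⟨ξ, η, hξ, hη, h⟩
      rw [← hξ, ← hη]
      exact hadd _ _ _ h
  have key' : ∀ x y z, z ∈ op x y ↔ e.symm z ∈ gluedAdd B (e.symm x) (e.symm y) := by
    intro x y z
    rw [← key]
    change _ ↔ e (e.symm z) ∈ op (e (e.symm x)) (e (e.symm y))
    simp
  refine ⟨⟨_, isCanonicalHypergroup_gluedAdd.of_equiv e.symm key'⟩, e.symm, fun x y => ?_⟩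
  ext z
  constructor
  · rintro ⟨w, hw, rfl⟩
    exact (key' _ _ _).1 hw
  · intro hz
    exact ⟨e z, (key' _ _ _).2 (by simpa using hz), by simp⟩

/-! ### An archimedean positivity criterion -/

section Archimedean

variable {R : Type*} [CommRing R] {v : R →+* ℝ} {P : Set R}

theorem linear_combination_mem_of_pos (add : ∀ x ∈ P, ∀ y ∈ P, x + y ∈ P)
    (sat : ∀ k : ℕ, 0 < k → ∀ z, (k : R) * z ∈ P → z ∈ P) {x y : R}
    (hx : ∀ n m : ℤ, 0 < n * v x - m → (n : R) * x - m ∈ P)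
    (hy : ∀ n m : ℤ, 0 < n * v y - m → (n : R) * y - m ∈ P)
    (a b m : ℤ) (h : 0 < a * v x + b * v y - m) : (a : R) * x + b * y - m ∈ P := by
  obtain ⟨q, hq1, hq2⟩ := exists_rat_btwn (show (m : ℝ) - b * v y < a * v x by linarith)
  have hd : (0 : ℝ) < q.den := by exact_mod_cast q.den_pos
  have hq : (q : ℝ) * q.den = q.num := by exact_mod_cast Rat.mul_den_eq_num q
  refine sat q.den q.den_pos _ ?_
  have h1 := hx (q.den * a) q.num (by push_cast; nlinarith)
  have h2 := hy (q.den * b) (q.den * m - q.num) (by push_cast; nlinarith)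
  convert add _ h1 _ h2 using 1
  push_cast
  ring

theorem mul_sub_mem_of_pos (add : ∀ x ∈ P, ∀ y ∈ P, x + y ∈ P)
    (mul : ∀ x ∈ P, ∀ y ∈ P, x * y ∈ P)
    (sat : ∀ k : ℕ, 0 < k → ∀ z, (k : R) * z ∈ P → z ∈ P) {x y : R}
    (hx : ∀ n m : ℤ, 0 < n * v x - m → (n : R) * x - m ∈ P)
    (hy : ∀ n m : ℤ, 0 < n * v y - m → (n : R) * y - m ∈ P)
    (n m : ℤ) (h : 0 < n * v (x * y) - m) : (n : R) * (x * y) - m ∈ P := by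
  rw [map_mul] at h
  set δ := n * (v x * v y) - m
  have hε : 0 < min 1 (δ / 2) := lt_min one_pos (half_pos h)
  set ε := min 1 (δ / 2)
  have hε1 : ε ≤ 1 := min_le_left _ _
  have hε2 : ε ≤ δ / 2 := min_le_right _ _
  obtain ⟨a, ha1, ha2⟩ := exists_rat_btwn (show n * v x - ε < n * v x by linarith)
  obtain ⟨b, hb1, hb2⟩ := exists_rat_btwn (show v y - ε < v y by linarith)
  have hda : (0 : ℝ) < a.den := by exact_mod_cast a.den_pos
  have hdb : (0 : ℝ) < b.den := by exact_mod_cast b.den_pos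
  have hqa : (a : ℝ) * a.den = a.num := by exact_mod_cast Rat.mul_den_eq_num a
  have hqb : (b : ℝ) * b.den = b.num := by exact_mod_cast Rat.mul_den_eq_num b
  have hab : (n * v x - a) * (v y - b) < δ := by nlinarith
  refine sat (a.den * b.den) (Nat.mul_pos a.den_pos b.den_pos) _ ?_
  have h1 := hx (a.den * n) a.num (by push_cast; nlinarith)
  have h2 := hy b.den b.num (by push_cast; nlinarith)
  have h3 := linear_combination_mem_of_pos add sat hx hy (b.num * a.den * n) (a.num * b.den)
    (a.num * b.num + a.den * b.den * m) (by
      have : 0 < a.den * b.den * (δ - (n * v x - a) * (v y - b)) :=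
        mul_pos (mul_pos hda hdb) (by linarith)
      push_cast
      rw [← hqa, ← hqb]
      convert this using 1
      simp only [δ]
      ring)
  convert add _ (mul _ h1 _ h2) _ h3 using 1
  push_cast
  ring

/-- A saturated semiring `P ⊆ R` that contains all linear polynomials with positive value in
each of a set of generators contains all elements with positive value. -/
theorem mem_of_pos_of_adjoin_eq_top (one : 1 ∈ P) (add : ∀ x ∈ P, ∀ y ∈ P, x + y ∈ P)
    (mul : ∀ x ∈ P, ∀ y ∈ P, x * y ∈ P)
    (sat : ∀ k : ℕ, 0 < k → ∀ z, (k : R) * z ∈ P → z ∈ P) {S : Set R}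
    (hS : ∀ z ∈ S, ∀ n m : ℤ, 0 < n * v z - m → (n : R) * z - m ∈ P)
    (htop : Algebra.adjoin ℤ S = ⊤) (z : R) (hz : 0 < v z) : z ∈ P := by
  have hnat : ∀ k : ℕ, 0 < k → (k : R) ∈ P := by
    intro k hk
    induction k, hk using Nat.le_induction with
    | base => simpa using one
    | succ k _ ih => push_cast; exact add _ ih _ one
  have hint : ∀ k : ℤ, (0 : ℝ) < k → (k : R) ∈ P := by
    intro k hk
    lift k to ℕ using (by exact_mod_cast hk.le)
    exact_mod_cast hnat k (by exact_mod_cast hk)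
  suffices ∀ n m : ℤ, 0 < n * v z - m → (n : R) * z - m ∈ P by
    simpa using this 1 0 (by simpa using hz)
  have hmem : z ∈ Algebra.adjoin ℤ S := htop ▸ Algebra.mem_top
  clear hz
  induction hmem using Algebra.adjoin_induction with
  | mem z hz => exact hS z hz
  | algebraMap r =>
    intro n m h
    have := hint (n * r - m) (by simpa using h)
    simpa using this
  | add x y _ _ hx hy =>
    intro n m h
    rw [mul_add]
    exact linear_combination_mem_of_pos add sat hx hy n n m (by rwa [map_add, mul_add] at h)
  | mul x y _ _ hx hy => exact mul_sub_mem_of_pos add mul sat hx hy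

end Archimedean

/-! ### Sums of signs -/

theorem sign_add_mem (x y : ℝ) :
    SignType.sign (x + y) ∈ signAdd (SignType.sign x) (SignType.sign y) := by
  rw [mem_signAdd]
  refine ⟨fun h => ?_, fun h => ?_, fun h => ?_⟩
  · rw [sign_eq_zero_iff.1 h, zero_add]
  · rw [sign_eq_zero_iff.1 h, add_zero]
  · rcases lt_trichotomy x 0 with hx | hx | hx
    · rw [sign_neg hx] at h ⊢
      exact sign_neg (add_neg hx (sign_eq_neg_one_iff.1 h.symm))
    · subst hx
      rw [zero_add, h]
    · rw [sign_pos hx] at h ⊢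
      exact sign_pos (add_pos hx (sign_eq_one_iff.1 h.symm))

theorem hadd_eq_signAdd (s t : SignType) : Hyperring.hadd s t = signAdd s t := rfl

theorem mem_hsum_cons {a : SignType} {l : List SignType} {u : SignType} :
    u ∈ hsum (a :: l) ↔ ∃ b ∈ hsum l, u ∈ signAdd a b := by
  simp [hsum, hadd_eq_signAdd]

theorem sign_sum_mem_hsum (l : List ℝ) : SignType.sign l.sum ∈ hsum (l.map SignType.sign) := by
  induction l with
  | nil => simp [hsum]
  | cons x l ih => exact mem_hsum_cons.2 ⟨_, ih, by simpa using sign_add_mem x l.sum⟩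

theorem eq_of_mem_hsum {l : List SignType} {σ u : SignType} (hne : l ≠ []) (h : ∀ s ∈ l, s = σ)
    (hu : u ∈ hsum l) : u = σ := by
  induction l generalizing u with
  | nil => exact absurd rfl hne
  | cons s l ih =>
    obtain ⟨b, hb, hu⟩ := mem_hsum_cons.1 hu
    obtain rfl := h s (by simp)
    rcases eq_or_ne l [] with rfl | hl
    · obtain rfl : b = 0 := by simpa [hsum] using hb
      exact ((mem_signAdd _ _ _).1 hu).2.1 rfl
    · exact ((mem_signAdd _ _ _).1 hu).2.2 (ih hl (fun t ht => h t (by simp [ht])) hb).symm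

theorem exists_of_mem_hsum_append {l₁ l₂ : List SignType} {u : SignType}
    (hu : u ∈ hsum (l₁ ++ l₂)) : ∃ v ∈ hsum l₁, ∃ w ∈ hsum l₂, u ∈ signAdd v w := by
  induction l₁ generalizing u with
  | nil => exact ⟨0, by simp [hsum], u, hu, (mem_signAdd _ _ _).2
      ⟨fun _ => rfl, fun h => h, fun h => h.symm⟩⟩
  | cons s l ih =>
    obtain ⟨b, hb, hu⟩ := mem_hsum_cons.1 hu
    obtain ⟨v, hv, w, hw, hb⟩ := ih hb
    rw [signAdd_comm] at hu hb
    obtain ⟨y, hy, hu⟩ := signAdd_assoc hb hu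
    rw [signAdd_comm] at hy hu
    exact ⟨y, mem_hsum_cons.2 ⟨v, hv, hy⟩, w, hw, hu⟩

/-! ### Homomorphisms to the hyperfield of signs -/

namespace HyperHom

variable {A : Type*} [CommRing A] (φ : HyperHom A SignType)

theorem ext {A R : Type*} [CommRing A] [Hyperring R] {φ ψ : HyperHom A R}
    (h : ∀ a, φ a = ψ a) : φ = ψ := by
  cases φ; cases ψ; congr; exact funext h

theorem map_add_eq_one {a b : A} (ha : φ a ≠ -1) (hb : φ b = 1) : φ (a + b) = 1 := by
  have h : φ (a + b) ∈ signAdd (φ a) (φ b) := φ.map_add a b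
  revert ha hb h
  generalize φ a = s, φ b = t, φ (a + b) = u
  revert s t u; decide

theorem map_neg (a : A) : φ (-a) = -φ a := by
  have h : φ (a + -a) ∈ signAdd (φ a) (φ (-a)) := φ.map_add a (-a)
  rw [add_neg_cancel, φ.map_zero] at h
  exact zero_mem_signAdd h

theorem map_natCast {k : ℕ} (hk : 0 < k) : φ (k : A) = 1 := by
  induction k, hk using Nat.le_induction with
  | base => simpa using φ.map_one
  | succ k _ ih => push_cast; exact φ.map_add_eq_one (by rw [ih]; decide) φ.map_one

theorem map_natCast_mul {k : ℕ} (hk : 0 < k) (a : A) : φ (k * a) = φ a := by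
  rw [φ.map_mul, φ.map_natCast hk, one_mul]

theorem map_intCast_mul {k : ℤ} (hk : 0 < k) (a : A) : φ (k * a) = φ a := by
  lift k to ℕ using hk.le
  exact_mod_cast φ.map_natCast_mul (by exact_mod_cast hk) a

theorem map_intCast {k : ℤ} (hk : 0 < k) : φ (k : A) = 1 := by
  rw [← mul_one (k : A), φ.map_intCast_mul hk, φ.map_one]

end HyperHom

/-! ### Functions centred at a real number -/

open Polynomial in
/-- `φ` takes the value `1` on all polynomials that are positive at `r`. -/
def IsCentered (r : ℝ) (φ : D) : Prop := ∀ p : ℤ[X], 0 < aeval r p → φ p = 1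

open Polynomial in
theorem IsCentered.eq_sign {r : ℝ} {φ : D} (h : IsCentered r φ) {p : ℤ[X]}
    (hp : aeval r p ≠ 0) : φ p = SignType.sign (aeval r p) := by
  rcases hp.lt_or_gt with hp | hp
  · have := h (-p) (by simpa using hp)
    rw [φ.map_neg] at this
    rw [sign_neg hp, ← neg_neg (φ p), this]
  · rw [sign_pos hp, h p hp]

open Polynomial in
theorem isCentered_of_re_eq {r : ℝ} {φ : D} (h : Re φ = r) : IsCentered r φ := by
  have hlin : ∀ n m : ℤ, 0 < n * r - m → φ ((n : ℤ[X]) * X - (m : ℤ[X])) = 1 := by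
    have low : ∀ q : ℚ, q < r → ∃ a : ℚ, q < a ∧ φ ((a.den : ℤ[X]) * X - (a.num : ℤ[X])) = 1 := by
      intro q hq
      have : ((q : ℝ) : EReal) < Re φ := by rw [h]; exact_mod_cast hq
      obtain ⟨_, ⟨a, ha, rfl⟩, hqa⟩ := lt_sSup_iff.1 this
      exact ⟨a, by exact_mod_cast hqa, by simpa using ha⟩
    have high : ∀ a : ℚ, r < a → φ ((a.den : ℤ[X]) * X - (a.num : ℤ[X])) ≠ 1 := by
      intro a ha hφ
      have : ((a : ℝ) : EReal) ≤ Re φ := le_sSup ⟨a, by simpa using hφ, rfl⟩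
      rw [h] at this
      exact absurd ha (not_lt.2 (by exact_mod_cast this))
    intro n m hnm
    rcases lt_trichotomy n 0 with hn | rfl | hn
    · obtain ⟨a, ha1, ha2⟩ := exists_rat_btwn (show r < ((m / n : ℚ) : ℝ) by
        have : (n : ℝ) < 0 := by exact_mod_cast hn
        push_cast
        rw [lt_div_iff_of_neg this]
        linarith)
      have hpos : 0 < n * a.num - m * a.den := by
        have h1 : (a : ℚ) < m / n := by exact_mod_cast ha2
        have h2 : (a : ℚ) * a.den = a.num := Rat.mul_den_eq_num a
        have h3 : (n : ℚ) < 0 := by exact_mod_cast hn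
        have h4 : (0 : ℚ) < a.den := by exact_mod_cast a.den_pos
        rw [lt_div_iff_of_neg h3] at h1
        have : (0 : ℚ) < n * a.num - m * a.den := by rw [← h2]; nlinarith
        exact_mod_cast this
      have h1 : φ (((-n : ℤ) : ℤ[X]) * -((a.den : ℤ[X]) * X - (a.num : ℤ[X]))) ≠ -1 := by
        rw [φ.map_intCast_mul (by omega), φ.map_neg]
        have := high a ha1
        revert this
        generalize φ _ = s
        revert s; decide
      have h2 := φ.map_add_eq_one h1 (φ.map_intCast hpos)
      rw [← φ.map_natCast_mul a.den_pos, ← h2]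
      congr 1
      push_cast
      ring
    · have hm : 0 < -m := by
        have : (0 : ℝ) < -m := by simpa using hnm
        exact_mod_cast this
      simpa using φ.map_intCast (A := ℤ[X]) hm
    · obtain ⟨a, ha1, ha2⟩ := low (m / n) (by
        have : (0 : ℝ) < n := by exact_mod_cast hn
        push_cast
        rw [div_lt_iff₀ this]
        linarith)
      have hpos : 0 < n * a.num - m * a.den := by
        have h2 : (a : ℚ) * a.den = a.num := Rat.mul_den_eq_num a
        have h3 : (0 : ℚ) < n := by exact_mod_cast hn
        have h4 : (0 : ℚ) < a.den := by exact_mod_cast a.den_pos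
        rw [div_lt_iff₀ h3] at ha1
        have : (0 : ℚ) < n * a.num - m * a.den := by rw [← h2]; nlinarith
        exact_mod_cast this
      have h2 := φ.map_add_eq_one (a := (n : ℤ[X]) * ((a.den : ℤ[X]) * X - (a.num : ℤ[X])))
        (by rw [φ.map_intCast_mul hn, ha2]; decide) (φ.map_intCast hpos)
      rw [← φ.map_natCast_mul a.den_pos, ← h2]
      congr 1
      push_cast
      ring
  refine mem_of_pos_of_adjoin_eq_top (v := (aeval r : ℤ[X] →ₐ[ℤ] ℝ).toRingHom)
    (P := {p | φ p = 1}) φ.map_one ?_ ?_ ?_ (S := {X}) ?_ Polynomial.adjoin_X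
  · exact fun x hx y hy => φ.map_add_eq_one (by rw [hx]; decide) hy
  · intro x hx y hy
    rw [Set.mem_ofPred_eq] at *
    rw [φ.map_mul, hx, hy, one_mul]
  · intro k hk z hz
    rwa [Set.mem_ofPred_eq, φ.map_natCast_mul hk] at hz
  · rintro _ rfl n m hnm
    exact hlin n m (by simpa using hnm)

open Polynomial in
theorem IsCentered.re_eq {r : ℝ} {φ : D} (h : IsCentered r φ) : Re φ = r := by
  have haeval : ∀ a : ℚ, aeval r (C (a.den : ℤ) * X - C a.num : ℤ[X]) = a.den * (r - a) := by
    intro a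
    have h2 : (a : ℝ) * a.den = a.num := by exact_mod_cast Rat.mul_den_eq_num a
    simp [← h2]
    ring
  have hd : ∀ a : ℚ, (0 : ℝ) < a.den := fun a => by exact_mod_cast a.den_pos
  refine le_antisymm (sSup_le ?_) (le_of_not_gt fun hlt => ?_)
  · rintro _ ⟨a, ha, rfl⟩
    by_contra! hra
    have hra : r < a := by exact_mod_cast hra
    have hneg : aeval r (C (a.den : ℤ) * X - C a.num : ℤ[X]) < 0 := by
      rw [haeval]
      exact mul_neg_of_pos_of_neg (hd a) (by linarith)
    rw [h.eq_sign hneg.ne, sign_neg hneg] at ha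
    exact absurd ha (by decide)
  · obtain ⟨a, ha1, ha2⟩ := EReal.lt_iff_exists_rat_btwn.1 hlt
    have har : (a : ℝ) < r := by exact_mod_cast ha2
    refine absurd ha1 (not_lt.2 (le_sSup ⟨a, h _ ?_, rfl⟩))
    rw [haeval]
    exact mul_pos (hd a) (by linarith)

theorem isCentered_iff {r : ℝ} {φ : D} : IsCentered r φ ↔ Re φ = r :=
  ⟨IsCentered.re_eq, isCentered_of_re_eq⟩

theorem mem_DFinite {φ : D} : φ ∈ DFinite ↔ ∃ r, IsCentered r φ := by
  simp only [isCentered_iff]; rfl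

/-! ### Separable relations -/

section Relations

open Polynomial

theorem exists_intPolynomial_multiple (f : ℚ[X]) :
    ∃ c : ℤ, c ≠ 0 ∧ ∃ g : ℤ[X], g.map (Int.castRingHom ℚ) = C (c : ℚ) * f := by
  obtain ⟨c, hc, h⟩ := IsLocalization.integerNormalization_spec (nonZeroDivisors ℤ) f
  refine ⟨c, nonZeroDivisors.ne_zero hc, _, h.trans ?_⟩
  rw [← smul_eq_C_mul, Int.cast_smul_eq_zsmul]

theorem squarefree_C_mul {c : ℤ} (hc : c ≠ 0) {f : ℚ[X]} (hf : Squarefree f) :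
    Squarefree (C (c : ℚ) * f) := by
  have hu : IsUnit (C (c : ℚ)) := isUnit_C.2 (isUnit_iff_ne_zero.2 (by exact_mod_cast hc))
  exact hf.squarefree_of_dvd ((hu.mul_left_dvd).2 dvd_rfl)

theorem exists_squarefree_aeval_eq_zero_of_field {K V : Type*} [Field K] [PerfectField K]
    [CommRing V] [Algebra K V] {a b : V} (htop : Algebra.adjoin K {a, b} = ⊤) {p q : K[X]}
    (hp : Squarefree p) (hq : Squarefree q) (ha : aeval a p = 0) (hb : aeval b q = 0) (z : V) :
    ∃ x : K[X], Squarefree x ∧ aeval z x = 0 := by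
  have hint : ∀ {c : V} {f : K[X]}, Squarefree f → aeval c f = 0 → IsIntegral K c :=
    fun hf hc => isAlgebraic_iff_isIntegral.1 ⟨_, hf.ne_zero, hc⟩
  have hfin : Module.Finite K V := by
    refine ⟨?_⟩
    have := fg_adjoin_of_finite (R := K) (s := {a, b}) (by simp) (by
      rintro c (rfl | rfl)
      exacts [hint hp ha, hint hq hb])
    rwa [htop, Algebra.top_toSubmodule] at this
  have hlm : ∀ (c : V) (f : K[X]), aeval (Algebra.lmul K V c) f = Algebra.lmul K V (aeval c f) :=
    fun c f => aeval_algHom_apply _ _ _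
  have hmem : Algebra.lmul K V z ∈ Algebra.adjoin K {Algebra.lmul K V a, Algebra.lmul K V b} := by
    rw [← Set.image_pair, ← AlgHom.map_adjoin, htop]
    exact ⟨z, Algebra.mem_top, rfl⟩
  have hs : (Algebra.lmul K V z : Module.End K V).IsSemisimple :=
    Module.End.IsSemisimple.of_mem_adjoin_pair
      ((Commute.all a b).map (Algebra.lmul K V))
      (Module.End.isSemisimple_of_squarefree_aeval_eq_zero hp (by rw [hlm, ha, map_zero]))
      (Module.End.isSemisimple_of_squarefree_aeval_eq_zero hq (by rw [hlm, hb, map_zero])) hmem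
  refine ⟨_, hs.minpoly_squarefree, ?_⟩
  apply Algebra.lmul_injective (R := K)
  rw [← hlm, minpoly.aeval, map_zero]

theorem exists_squarefree_aeval_eq_zero {R : Type*} [CommRing R] {a b : R}
    (htop : Algebra.adjoin ℤ {a, b} = ⊤) {p q : ℤ[X]}
    (hp : Squarefree (p.map (Int.castRingHom ℚ))) (hq : Squarefree (q.map (Int.castRingHom ℚ)))
    (ha : aeval a p = 0) (hb : aeval b q = 0) (z : R) :
    ∃ x : ℤ[X], Squarefree (x.map (Int.castRingHom ℚ)) ∧ aeval z x = 0 := by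
  let i : R →ₐ[ℤ] ℚ ⊗[ℤ] R := Algebra.TensorProduct.includeRight
  have hi : ∀ (c : R) (f : ℤ[X]), aeval (i c) (f.map (Int.castRingHom ℚ)) = i (aeval c f) := by
    intro c f
    rw [← aeval_algHom_apply]
    exact aeval_map_algebraMap ℚ (i c) f
  have htop' : Algebra.adjoin ℚ {i a, i b} = ⊤ := by
    have h1 : ∀ c, i c ∈ Algebra.adjoin ℚ {i a, i b} := by
      intro c
      have hc : c ∈ Algebra.adjoin ℤ {a, b} := htop ▸ Algebra.mem_top
      induction hc using Algebra.adjoin_induction with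
      | mem c hc =>
        apply Algebra.subset_adjoin
        rcases hc with rfl | rfl <;> simp
      | algebraMap r => simp
      | add x y _ _ hx hy => rw [map_add]; exact add_mem hx hy
      | mul x y _ _ hx hy => rw [map_mul]; exact mul_mem hx hy
    rw [eq_top_iff]
    rintro w -
    induction w using TensorProduct.induction_on with
    | zero => exact zero_mem _
    | add x y hx hy => exact add_mem hx hy
    | tmul r c =>
      have : r ⊗ₜ[ℤ] c = r • i c := by
        simp [i, TensorProduct.smul_tmul']
      rw [this]
      exact Subalgebra.smul_mem _ (h1 c) r
  obtain ⟨x, hx, hxz⟩ := exists_squarefree_aeval_eq_zero_of_field htop' hp hq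
    (by rw [hi, ha, map_zero]) (by rw [hi, hb, map_zero]) (i z)
  obtain ⟨c, hc, g, hg⟩ := exists_intPolynomial_multiple x
  have h0 : i (aeval z g) = 0 := by rw [← hi, hg, map_mul, hxz, mul_zero]
  have : TensorProduct.mk ℤ ℚ R 1 (aeval z g) = 0 := h0
  obtain ⟨⟨k, hk⟩, hkz⟩ := (IsLocalizedModule.eq_zero_iff (nonZeroDivisors ℤ) _).1 this
  have hk0 := nonZeroDivisors.ne_zero hk
  refine ⟨C k * g, ?_, ?_⟩
  · rw [Polynomial.map_mul, hg, map_C]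
    exact squarefree_C_mul hk0 (squarefree_C_mul hc hx)
  · rw [map_mul, aeval_C, ← Algebra.smul_def]
    exact hkz

theorem aeval_X_tmul_one (f : ℤ[X]) : aeval ((X : ℤ[X]) ⊗ₜ[ℤ] (1 : ℤ[X])) f = f ⊗ₜ[ℤ] 1 := by
  conv_rhs => rw [← aeval_X_left_apply f]
  exact aeval_algHom_apply
    (Algebra.TensorProduct.includeLeft : ℤ[X] →ₐ[ℤ] ℤ[X] ⊗[ℤ] ℤ[X]) X f

theorem aeval_one_tmul_X (f : ℤ[X]) : aeval ((1 : ℤ[X]) ⊗ₜ[ℤ] (X : ℤ[X])) f = 1 ⊗ₜ[ℤ] f := by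
  conv_rhs => rw [← aeval_X_left_apply f]
  exact aeval_algHom_apply
    (Algebra.TensorProduct.includeRight : ℤ[X] →ₐ[ℤ] ℤ[X] ⊗[ℤ] ℤ[X]) X f

theorem adjoin_tensor_eq_top :
    Algebra.adjoin ℤ {(X : ℤ[X]) ⊗ₜ[ℤ] (1 : ℤ[X]), (1 : ℤ[X]) ⊗ₜ[ℤ] (X : ℤ[X])} = ⊤ := by
  set S := Algebra.adjoin ℤ {(X : ℤ[X]) ⊗ₜ[ℤ] (1 : ℤ[X]), (1 : ℤ[X]) ⊗ₜ[ℤ] (X : ℤ[X])}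
  have h1 : ∀ f : ℤ[X], f ⊗ₜ[ℤ] (1 : ℤ[X]) ∈ S := fun f =>
    aeval_X_tmul_one f ▸ Algebra.adjoin_mono (by simp) (aeval_mem_adjoin_singleton ℤ _)
  have h2 : ∀ f : ℤ[X], (1 : ℤ[X]) ⊗ₜ[ℤ] f ∈ S := fun f =>
    aeval_one_tmul_X f ▸ Algebra.adjoin_mono (by simp) (aeval_mem_adjoin_singleton ℤ _)
  rw [eq_top_iff]
  rintro w -
  induction w using TensorProduct.induction_on with
  | zero => exact zero_mem _
  | add x y hx hy => exact add_mem hx hy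
  | tmul f g =>
    have : f ⊗ₜ[ℤ] g = (f ⊗ₜ[ℤ] (1 : ℤ[X])) * ((1 : ℤ[X]) ⊗ₜ[ℤ] g) := by simp
    rw [this]
    exact mul_mem (h1 f) (h2 g)

/-- For square-free `p`, `q`, any element of `ℤ[T] ⊗ ℤ[T]` satisfies a square-free equation modulo
the ideal generated by `p ⊗ 1` and `1 ⊗ q`. -/
theorem exists_squarefree_aeval_eq_add {p q : ℤ[X]}
    (hp : Squarefree (p.map (Int.castRingHom ℚ))) (hq : Squarefree (q.map (Int.castRingHom ℚ)))
    (Δ : ℤ[X] →ₐ[ℤ] ℤ[X] ⊗[ℤ] ℤ[X]) :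
    ∃ (x : ℤ[X]) (a b : ℤ[X] ⊗[ℤ] ℤ[X]), Squarefree (x.map (Int.castRingHom ℚ)) ∧
      Δ x = (p ⊗ₜ[ℤ] 1) * a + (1 ⊗ₜ[ℤ] q) * b := by
  let I : Ideal (ℤ[X] ⊗[ℤ] ℤ[X]) := Ideal.span {p ⊗ₜ[ℤ] 1, 1 ⊗ₜ[ℤ] q}
  let π : ℤ[X] ⊗[ℤ] ℤ[X] →ₐ[ℤ] (ℤ[X] ⊗[ℤ] ℤ[X]) ⧸ I := Ideal.Quotient.mkₐ ℤ I
  have htop : Algebra.adjoin ℤ {π (X ⊗ₜ[ℤ] 1), π (1 ⊗ₜ[ℤ] X)} = ⊤ := by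
    rw [← Set.image_pair, ← AlgHom.map_adjoin, adjoin_tensor_eq_top, Algebra.map_top]
    exact (AlgHom.range_eq_top _).2 (Ideal.Quotient.mkₐ_surjective ℤ I)
  obtain ⟨x, hx, hx0⟩ := exists_squarefree_aeval_eq_zero htop hp hq
    (by
      rw [aeval_algHom_apply, aeval_X_tmul_one]
      exact Ideal.Quotient.eq_zero_iff_mem.2 (Ideal.subset_span (by simp)))
    (by
      rw [aeval_algHom_apply, aeval_one_tmul_X]
      exact Ideal.Quotient.eq_zero_iff_mem.2 (Ideal.subset_span (by simp))) (π (Δ X))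
  rw [aeval_algHom_apply, aeval_algHom_apply, aeval_X_left_apply] at hx0
  obtain ⟨a, b, hab⟩ := Ideal.mem_span_pair.1 (Ideal.Quotient.eq_zero_iff_mem.1 hx0)
  exact ⟨x, a, b, hx, by rw [← hab]; ring⟩

theorem aeval_derivative_ne_zero_of_squarefree {x : ℤ[X]}
    (hx : Squarefree (x.map (Int.castRingHom ℚ))) {r : ℝ} (h : aeval r x = 0) :
    aeval r (derivative x) ≠ 0 := by
  have hsep := PerfectField.separable_iff_squarefree.2 hx
  have h0 : aeval r (x.map (Int.castRingHom ℚ)) = 0 := by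
    rw [← h]; exact aeval_map_algebraMap ℚ r x
  have h1 := hsep.aeval_derivative_ne_zero h0
  rw [derivative_map] at h1
  intro h2
  exact h1 (by rw [← h2]; exact aeval_map_algebraMap ℚ r _)

/-- The ideal of polynomials vanishing at a real algebraic number has, up to integral multiples,
a square-free generator. -/
theorem exists_squarefree_generator {r : ℝ} (hr : IsAlgebraic ℚ r) :
    ∃ p : ℤ[X], Squarefree (p.map (Int.castRingHom ℚ)) ∧ aeval r p = 0 ∧
      ∀ f : ℤ[X], aeval r f = 0 → ∃ c : ℤ, c ≠ 0 ∧ p ∣ (c : ℤ[X]) * f := by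
  have hirr := minpoly.irreducible hr.isIntegral
  obtain ⟨c, hc, p, hp⟩ := exists_intPolynomial_multiple (minpoly ℚ r)
  have hmap : ∀ f : ℤ[X], aeval r (f.map (Int.castRingHom ℚ)) = aeval r f :=
    fun f => aeval_map_algebraMap ℚ r f
  refine ⟨p, hp ▸ squarefree_C_mul hc hirr.squarefree, ?_, fun f hf => ?_⟩
  · rw [← hmap, hp, map_mul, minpoly.aeval, mul_zero]
  · obtain ⟨g, hg⟩ := minpoly.dvd ℚ r ((hmap f).trans hf)
    obtain ⟨d, hd, h, hh⟩ := exists_intPolynomial_multiple g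
    refine ⟨c * d, mul_ne_zero hc hd, h, ?_⟩
    apply map_injective (Int.castRingHom ℚ) Int.cast_injective
    rw [Polynomial.map_mul, Polynomial.map_mul, hg, hp, hh]
    simp
    ring

end Relations

/-! ### Signs of germs of polynomials -/

section Germs

open Polynomial Filter Topology

/-- The filter of neighbourhoods of `r` in the points lying on the side `s` of `r`; for `s = 0`
this is the point `r` itself. -/
noncomputable def side (r : ℝ) (s : SignType) : Filter ℝ :=
  𝓝[{y | SignType.sign (y - r) = s}] r

theorem tendsto_side {ι : Type*} {l : Filter ι} {γ : ι → ℝ} {r : ℝ} {s : SignType}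
    (h : Tendsto γ l (𝓝 r)) (hs : ∀ᶠ i in l, SignType.sign (γ i - r) = s) :
    Tendsto γ l (side r s) :=
  tendsto_nhdsWithin_iff.2 ⟨h, hs⟩

theorem sign_coe_mul (s : SignType) {x : ℝ} (hx : 0 < x) : SignType.sign ((s : ℝ) * x) = s := by
  rw [sign_mul, sign_pos hx, mul_one]
  cases s <;> simp

instance side_neBot (r : ℝ) (s : SignType) : (side r s).NeBot := by
  have h : Tendsto (fun ε : ℝ => r + s * ε) (𝓝[>] 0) (side r s) := by
    refine tendsto_side ?_ ?_
    · have : Tendsto (fun ε : ℝ => r + s * ε) (𝓝 0) (𝓝 (r + s * 0)) :=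
        (Continuous.tendsto (by fun_prop) 0)
      simpa using this.mono_left nhdsWithin_le_nhds
    · filter_upwards [self_mem_nhdsWithin] with ε hε
      rw [add_sub_cancel_left, sign_coe_mul s hε]
  exact h.neBot

theorem eventually_sign_eq_of_ne_zero {r : ℝ} {p : ℝ[X]} (hp : p.eval r ≠ 0) :
    ∀ᶠ y in 𝓝 r, SignType.sign (p.eval y) = SignType.sign (p.eval r) := by
  have hc : Tendsto (fun y => p.eval y) (𝓝 r) (𝓝 (p.eval r)) := p.continuous.tendsto r
  rcases hp.lt_or_gt with h | h
  · filter_upwards [hc.eventually (gt_mem_nhds h)] with y hy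
    rw [sign_neg hy, sign_neg h]
  · filter_upwards [hc.eventually (lt_mem_nhds h)] with y hy
    rw [sign_pos hy, sign_pos h]

theorem eventually_sign_pow_mul {r : ℝ} (s : SignType) {p : ℝ[X]} (hp : p.eval r ≠ 0) (k : ℕ) :
    ∀ᶠ y in side r s, SignType.sign (((X - C r) ^ k * p).eval y) =
      s ^ k * SignType.sign (p.eval r) := by
  filter_upwards [nhdsWithin_le_nhds (eventually_sign_eq_of_ne_zero hp), self_mem_nhdsWithin]
    with y h1 h2
  have h2 : SignType.sign (y - r) = s := h2
  rw [eval_mul, sign_mul, h1, eval_pow, sign_pow]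
  simp [h2]

theorem exists_eventually_sign_eq (r : ℝ) (s : SignType) (p : ℤ[X]) :
    ∃ σ, ∀ᶠ y in side r s, SignType.sign (aeval y p) = σ := by
  have hmap : ∀ y : ℝ, aeval y p = (p.map (Int.castRingHom ℝ)).eval y := fun y =>
    aeval_def (R := ℤ) y p ▸ (eval_map (Int.castRingHom ℝ) y).symm
  simp only [hmap]
  rcases eq_or_ne (p.map (Int.castRingHom ℝ)) 0 with h | h
  · exact ⟨0, by simp [h]⟩
  · obtain ⟨q, hq, hdvd⟩ := exists_eq_pow_rootMultiplicity_mul_and_not_dvd _ h r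
    rw [dvd_iff_isRoot] at hdvd
    rw [hq]
    exact ⟨_, eventually_sign_pow_mul s hdvd _⟩

/-- The sign of a polynomial near `r` on the side `s`. -/
noncomputable def germSign (r : ℝ) (s : SignType) (p : ℤ[X]) : SignType :=
  (exists_eventually_sign_eq r s p).choose

theorem eventually_germSign (r : ℝ) (s : SignType) (p : ℤ[X]) :
    ∀ᶠ y in side r s, SignType.sign (aeval y p) = germSign r s p :=
  (exists_eventually_sign_eq r s p).choose_spec

theorem germSign_eq {r : ℝ} {s σ : SignType} {p : ℤ[X]}
    (h : ∃ᶠ y in side r s, SignType.sign (aeval y p) = σ) : germSign r s p = σ := by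
  obtain ⟨y, h1, h2⟩ := (h.and_eventually (eventually_germSign r s p)).exists
  rw [← h1, ← h2]

/-- The homomorphism `ℤ[T] → 𝐒` given by the signs near `r` on the side `s`. -/
noncomputable def germ (r : ℝ) (s : SignType) : D where
  toFun := germSign r s
  map_zero := germSign_eq (Eventually.frequently (by simp))
  map_one := germSign_eq (Eventually.frequently (by simp))
  map_add p q := by
    obtain ⟨y, ⟨h1, h2⟩, h3⟩ := ((eventually_germSign r s p).and
      (eventually_germSign r s q)).and (eventually_germSign r s (p + q)) |>.exists
    rw [← h1, ← h2, ← h3, map_add]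
    exact sign_add_mem _ _
  map_mul p q := by
    obtain ⟨y, ⟨h1, h2⟩, h3⟩ := ((eventually_germSign r s p).and
      (eventually_germSign r s q)).and (eventually_germSign r s (p * q)) |>.exists
    rw [← h1, ← h2, ← h3, map_mul, sign_mul]

theorem eventually_germ (r : ℝ) (s : SignType) (p : ℤ[X]) :
    ∀ᶠ y in side r s, SignType.sign (aeval y p) = germ r s p :=
  eventually_germSign r s p

theorem isCentered_germ (r : ℝ) (s : SignType) : IsCentered r (germ r s) := by
  intro p hp
  refine germSign_eq (Eventually.frequently ?_)
  have : Tendsto (fun y : ℝ => aeval y p) (side r s) (𝓝 (aeval r p)) :=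
    (p.continuous_aeval.tendsto r).mono_left nhdsWithin_le_nhds
  filter_upwards [this.eventually (lt_mem_nhds hp)] with y hy
  exact sign_pos hy

theorem germ_mem_DFinite (r : ℝ) (s : SignType) : germ r s ∈ DFinite :=
  mem_DFinite.2 ⟨r, isCentered_germ r s⟩

theorem germ_of_simple_root {r : ℝ} (s : SignType) {p : ℤ[X]} (h0 : aeval r p = 0)
    (h1 : aeval r (derivative p) ≠ 0) :
    germ r s p = s * SignType.sign (aeval r (derivative p)) := by
  refine germSign_eq (Eventually.frequently ?_)
  have hmap : ∀ (f : ℤ[X]) (y : ℝ), aeval y f = (f.map (Int.castRingHom ℝ)).eval y := fun f y =>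
    aeval_def (R := ℤ) y f ▸ (eval_map (Int.castRingHom ℝ) y).symm
  simp only [hmap] at *
  obtain ⟨q, hq⟩ := dvd_iff_isRoot.2 h0
  have hd : ((derivative p).map (Int.castRingHom ℝ)).eval r = q.eval r := by
    rw [← derivative_map, hq]
    simp
  rw [hd] at h1 ⊢
  have := eventually_sign_pow_mul s h1 1
  rwa [pow_one, pow_one, ← hq] at this

theorem IsCentered.eq_of_transcendental {r : ℝ} {φ ψ : D} (hφ : IsCentered r φ)
    (hψ : IsCentered r ψ) (hr : ¬IsAlgebraic ℚ r) : φ = ψ := by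
  refine HyperHom.ext fun p => ?_
  rcases eq_or_ne p 0 with rfl | hp
  · rw [φ.map_zero, ψ.map_zero]
  · have : aeval r p ≠ 0 := fun h =>
      hr (IsAlgebraic.extendScalars (R := ℤ) Int.cast_injective ⟨p, hp, h⟩)
    rw [hφ.eq_sign this, hψ.eq_sign this]

theorem IsCentered.eq_of_eq_generator {r : ℝ} {φ ψ : D} (hφ : IsCentered r φ)
    (hψ : IsCentered r ψ) {p : ℤ[X]} (hp : aeval r p = 0)
    (hdvd : ∀ f : ℤ[X], aeval r f = 0 → ∃ c : ℤ, c ≠ 0 ∧ p ∣ (c : ℤ[X]) * f)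
    (h : φ p = ψ p) : φ = ψ := by
  refine HyperHom.ext fun f => ?_
  induction hn : f.natDegree using Nat.strong_induction_on generalizing f with
  | _ n ih =>
    rcases eq_or_ne f 0 with rfl | hf
    · rw [φ.map_zero, ψ.map_zero]
    by_cases hfr : aeval r f = 0
    · obtain ⟨c, hc, g, hg⟩ := hdvd f hfr
      have hc' : (c : ℤ[X]) ≠ 0 := by exact_mod_cast hc
      have hpg : p * g ≠ 0 := hg ▸ mul_ne_zero hc' hf
      have hp0 : p ≠ 0 := left_ne_zero_of_mul hpg
      have hpd : 0 < p.natDegree := by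
        by_contra! h0
        rw [eq_C_of_natDegree_le_zero h0, aeval_C] at hp
        apply hp0
        rw [eq_C_of_natDegree_le_zero h0, show p.coeff 0 = 0 by simpa using hp, C_0]
      have hdeg := congrArg natDegree hg
      rw [natDegree_mul hc' hf, natDegree_mul hp0 (right_ne_zero_of_mul hpg), natDegree_intCast]
        at hdeg
      have hgφ := ih g.natDegree (by omega) g rfl
      have hcr : aeval r (c : ℤ[X]) ≠ 0 := by simpa using hc
      have hφc : φ (c : ℤ[X]) = ψ (c : ℤ[X]) := by rw [hφ.eq_sign hcr, hψ.eq_sign hcr]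
      have hψc : ψ (c : ℤ[X]) ≠ 0 := by
        rw [hψ.eq_sign hcr]
        exact sign_ne_zero.2 hcr
      have e1 := congrArg φ hg
      have e2 := congrArg ψ hg
      rw [φ.map_mul, φ.map_mul, h, hgφ, hφc, ← ψ.map_mul p g, ← e2, ψ.map_mul] at e1
      exact mul_left_cancel₀ hψc e1
    · rw [hφ.eq_sign hfr, hψ.eq_sign hfr]

theorem IsCentered.exists_eq_germ {r : ℝ} {φ : D} (hφ : IsCentered r φ) :
    ∃ s, φ = germ r s := by
  by_cases hr : IsAlgebraic ℚ r
  · obtain ⟨p, hsq, hp, hdvd⟩ := exists_squarefree_generator hr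
    have hd := aeval_derivative_ne_zero_of_squarefree hsq hp
    refine ⟨φ p * SignType.sign (aeval r (derivative p)),
      hφ.eq_of_eq_generator (isCentered_germ _ _) hp hdvd ?_⟩
    rw [germ_of_simple_root _ hp hd, mul_assoc, ← sign_mul, sign_pos (mul_self_pos.2 hd), mul_one]
  · exact ⟨0, hφ.eq_of_transcendental (isCentered_germ _ _) hr⟩

theorem IsCentered.unique {r r' : ℝ} {φ : D} (h : IsCentered r φ) (h' : IsCentered r' φ) :
    r = r' := by
  have := h.re_eq.symm.trans h'.re_eq
  exact_mod_cast this

theorem germ_eq_germ {r r' : ℝ} {s s' : SignType} :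
    germ r s = germ r' s' ↔ r = r' ∧ (IsAlgebraic ℚ r → s = s') := by
  constructor
  · intro h
    obtain rfl := (isCentered_germ r s).unique (h ▸ isCentered_germ r' s')
    refine ⟨rfl, fun hr => ?_⟩
    obtain ⟨p, hsq, hp, -⟩ := exists_squarefree_generator hr
    have hd := aeval_derivative_ne_zero_of_squarefree hsq hp
    have e : germ r s p = germ r s' p := by rw [h]
    rw [germ_of_simple_root _ hp hd, germ_of_simple_root _ hp hd] at e
    exact mul_right_cancel₀ (sign_ne_zero.2 hd) e
  · rintro ⟨rfl, h⟩
    by_cases hr : IsAlgebraic ℚ r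
    · rw [h hr]
    · exact (isCentered_germ r s).eq_of_transcendental (isCentered_germ r s') hr

theorem mem_DFinite_iff_germ {φ : D} : φ ∈ DFinite ↔ ∃ r s, φ = germ r s := by
  constructor
  · intro h
    obtain ⟨r, hr⟩ := mem_DFinite.1 h
    exact ⟨r, hr.exists_eq_germ⟩
  · rintro ⟨r, s, rfl⟩
    exact germ_mem_DFinite r s

end Germs

/-! ### The convolution of germs -/

section Star

open Polynomial Filter Topology

/-- Evaluation of elements of `ℤ[T] ⊗ ℤ[T]` at a point of the real plane. -/
noncomputable def evalPair (a b : ℝ) : ℤ[X] ⊗[ℤ] ℤ[X] →ₐ[ℤ] ℝ :=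
  Algebra.TensorProduct.productMap (aeval a) (aeval b)

@[simp] theorem evalPair_tmul (a b : ℝ) (f g : ℤ[X]) :
    evalPair a b (f ⊗ₜ[ℤ] g) = aeval a f * aeval b g := rfl

theorem germ_mem_star {Δ : ℤ[X] →ₐ[ℤ] ℤ[X] ⊗[ℤ] ℤ[X]} {F : ℝ → ℝ → ℝ}
    (hΔ : ∀ a b x, evalPair a b (Δ x) = aeval (F a b) x) {a b c : ℝ} {s t u : SignType}
    {ι : Type*} {l : Filter ι} [l.NeBot] {α β : ι → ℝ} (hα : Tendsto α l (side a s))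
    (hβ : Tendsto β l (side b t)) (hF : Tendsto (fun i => F (α i) (β i)) l (side c u)) :
    germ c u ∈ star Δ (germ a s) (germ b t) := by
  intro x L hL
  have h1 : ∀ᶠ i in l, ∀ p ∈ L,
      SignType.sign (evalPair (α i) (β i) (p.1 ⊗ₜ[ℤ] p.2)) = germ a s p.1 * germ b t p.2 := by
    have := (eventually_all_finite (List.finite_toSet L)).2 fun p _ =>
      (hα.eventually (eventually_germ a s p.1)).and (hβ.eventually (eventually_germ b t p.2))
    filter_upwards [this] with i hi p hp
    rw [evalPair_tmul, sign_mul, (hi p hp).1, (hi p hp).2]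
  obtain ⟨i, h1, h2⟩ := (h1.and (hF.eventually (eventually_germ c u x))).exists
  rw [← h2, ← hΔ, hL, map_list_sum, List.map_map]
  have := sign_sum_mem_hsum (L.map (evalPair (α i) (β i) ∘ fun p => p.1 ⊗ₜ[ℤ] p.2))
  rw [List.map_map] at this
  convert this using 2
  exact List.map_congr_left fun p hp => (h1 p hp).symm

/-- `z` is a non-empty sum of elementary tensors `f ⊗ g` with `φ(f) ψ(g) = σ`. -/
def HasSign (φ ψ : D) (σ : SignType) (z : ℤ[X] ⊗[ℤ] ℤ[X]) : Prop :=
  ∃ L : List (ℤ[X] × ℤ[X]), L ≠ [] ∧ (∀ p ∈ L, φ p.1 * ψ p.2 = σ) ∧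
    z = (L.map fun p => p.1 ⊗ₜ[ℤ] p.2).sum

theorem HasSign.add {φ ψ : D} {σ : SignType} {z w : ℤ[X] ⊗[ℤ] ℤ[X]} (hz : HasSign φ ψ σ z)
    (hw : HasSign φ ψ σ w) : HasSign φ ψ σ (z + w) := by
  obtain ⟨L, hL, h, rfl⟩ := hz
  obtain ⟨M, -, h', rfl⟩ := hw
  refine ⟨L ++ M, by simp [hL], fun p hp => ?_, by simp⟩
  rcases List.mem_append.1 hp with hp | hp
  exacts [h p hp, h' p hp]

theorem HasSign.tmul_mul {φ ψ : D} {σ : SignType} {z : ℤ[X] ⊗[ℤ] ℤ[X]} (hz : HasSign φ ψ σ z)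
    (f g : ℤ[X]) : HasSign φ ψ (φ f * ψ g * σ) ((f ⊗ₜ[ℤ] g) * z) := by
  obtain ⟨L, hL, h, rfl⟩ := hz
  refine ⟨L.map fun p => (f * p.1, g * p.2), by simp [hL], ?_, ?_⟩
  · simp only [List.mem_map, forall_exists_index, and_imp, forall_apply_eq_imp_iff₂]
    intro p hp
    rw [φ.map_mul, ψ.map_mul, mul_mul_mul_comm, h p hp]
  · rw [← List.sum_map_mul_left, List.map_map]
    simp [Function.comp_def]

theorem hasSign_tmul {φ ψ : D} (f g : ℤ[X]) : HasSign φ ψ (φ f * ψ g) (f ⊗ₜ[ℤ] g) :=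
  ⟨[(f, g)], by simp, by simp, by simp⟩

theorem natCast_eq_tmul (k : ℕ) : (k : ℤ[X] ⊗[ℤ] ℤ[X]) = (k : ℤ[X]) ⊗ₜ[ℤ] (1 : ℤ[X]) := by
  rw [← map_natCast (Algebra.TensorProduct.includeLeft : ℤ[X] →ₐ[ℤ] ℤ[X] ⊗[ℤ] ℤ[X]) k]
  rfl

theorem HasSign.natCast_mul {φ ψ : D} {σ : SignType} {z : ℤ[X] ⊗[ℤ] ℤ[X]}
    (hz : HasSign φ ψ σ z) {k : ℕ} (hk : 0 < k) : HasSign φ ψ σ (k * z) := by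
  have := hz.tmul_mul k 1
  rwa [φ.map_natCast hk, ψ.map_one, one_mul, one_mul, ← natCast_eq_tmul] at this

theorem HasSign.mul {φ ψ : D} {z w : ℤ[X] ⊗[ℤ] ℤ[X]} (hz : HasSign φ ψ 1 z)
    (hw : HasSign φ ψ 1 w) : HasSign φ ψ 1 (z * w) := by
  obtain ⟨L, hL, h, rfl⟩ := hz
  induction L with
  | nil => exact absurd rfl hL
  | cons p L ih =>
    rw [List.map_cons, List.sum_cons, add_mul]
    have h1 : HasSign φ ψ 1 (p.1 ⊗ₜ[ℤ] p.2 * w) := by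
      have := hw.tmul_mul p.1 p.2
      rwa [h p (by simp), one_mul] at this
    rcases eq_or_ne L [] with rfl | hL'
    · simpa using h1
    · exact h1.add (ih hL' fun q hq => h q (by simp [hq]))

theorem mem_signAdd_of_hasSign {Δ : ℤ[X] →ₐ[ℤ] ℤ[X] ⊗[ℤ] ℤ[X]} {φ ψ χ : D}
    (hχ : χ ∈ star Δ φ ψ) {x : ℤ[X]} {z w : ℤ[X] ⊗[ℤ] ℤ[X]} {σ τ : SignType}
    (hz : HasSign φ ψ σ z) (hw : HasSign φ ψ τ w) (hx : Δ x = z + w) : χ x ∈ signAdd σ τ := by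
  obtain ⟨L, hL, h, rfl⟩ := hz
  obtain ⟨M, hM, h', rfl⟩ := hw
  have := hχ x (L ++ M) (by simp [hx])
  rw [List.map_append] at this
  obtain ⟨v, hv, w, hw, hvw⟩ := exists_of_mem_hsum_append this
  rw [eq_of_mem_hsum (σ := σ) (by simpa using hL) (List.forall_mem_map.2 h) hv,
    eq_of_mem_hsum (σ := τ) (by simpa using hM) (List.forall_mem_map.2 h') hw]
    at hvw
  exact hvw

theorem exists_hasSign_one {a b : ℝ} {φ ψ : D} (hφ : IsCentered a φ) (hψ : IsCentered b ψ)
    {z : ℤ[X] ⊗[ℤ] ℤ[X]} (hz : 0 < evalPair a b z) :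
    ∃ k : ℕ, 0 < k ∧ HasSign φ ψ 1 (k * z) := by
  refine mem_of_pos_of_adjoin_eq_top (v := (evalPair a b).toRingHom)
    (P := {z | ∃ k : ℕ, 0 < k ∧ HasSign φ ψ 1 (k * z)}) ?_ ?_ ?_ ?_ ?_ adjoin_tensor_eq_top z hz
  · refine ⟨1, one_pos, ?_⟩
    have := hasSign_tmul (φ := φ) (ψ := ψ) 1 1
    rw [φ.map_one, ψ.map_one, one_mul] at this
    simpa [Algebra.TensorProduct.one_def] using this
  · rintro x ⟨k, hk, hx⟩ y ⟨m, hm, hy⟩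
    refine ⟨k * m, Nat.mul_pos hk hm, ?_⟩
    convert (hx.natCast_mul hm).add (hy.natCast_mul hk) using 1
    push_cast
    ring
  · rintro x ⟨k, hk, hx⟩ y ⟨m, hm, hy⟩
    refine ⟨k * m, Nat.mul_pos hk hm, ?_⟩
    convert hx.mul hy using 1
    push_cast
    ring
  · rintro k hk x ⟨m, hm, hx⟩
    refine ⟨m * k, Nat.mul_pos hm hk, ?_⟩
    rwa [Nat.cast_mul, mul_assoc]
  · rintro x (rfl | rfl) n m hnm
    · refine ⟨1, one_pos, ?_⟩
      have h1 : φ ((n : ℤ[X]) * X - (m : ℤ[X])) = 1 := hφ _ (by simpa using hnm)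
      have := hasSign_tmul (φ := φ) (ψ := ψ) ((n : ℤ[X]) * X - (m : ℤ[X])) 1
      rw [h1, ψ.map_one, one_mul] at this
      convert this using 1
      rw [← aeval_X_tmul_one ((n : ℤ[X]) * X - (m : ℤ[X]))]
      simp
    · refine ⟨1, one_pos, ?_⟩
      have h1 : ψ ((n : ℤ[X]) * X - (m : ℤ[X])) = 1 := hψ _ (by simpa using hnm)
      have := hasSign_tmul (φ := φ) (ψ := ψ) 1 ((n : ℤ[X]) * X - (m : ℤ[X]))
      rw [h1, φ.map_one, one_mul] at this
      convert this using 1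
      rw [← aeval_one_tmul_X ((n : ℤ[X]) * X - (m : ℤ[X]))]
      simp

theorem exists_hasSign {a b : ℝ} {φ ψ : D} (hφ : IsCentered a φ) (hψ : IsCentered b ψ)
    {z : ℤ[X] ⊗[ℤ] ℤ[X]} (hz : evalPair a b z ≠ 0) :
    ∃ k : ℕ, 0 < k ∧ HasSign φ ψ (SignType.sign (evalPair a b z)) (k * z) := by
  rcases hz.lt_or_gt with h | h
  · obtain ⟨k, hk, hs⟩ := exists_hasSign_one hφ hψ (z := ((-1) ⊗ₜ[ℤ] 1) * z) (by simpa using h)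
    refine ⟨k, hk, ?_⟩
    have he : ((-1 : ℤ[X]) ⊗ₜ[ℤ] (1 : ℤ[X])) * ((-1) ⊗ₜ[ℤ] 1) = 1 := by
      simp [Algebra.TensorProduct.one_def]
    have := hs.tmul_mul (-1) 1
    rw [φ.map_neg, φ.map_one, ψ.map_one, mul_one, mul_one] at this
    rw [sign_neg h]
    convert this using 1
    rw [mul_left_comm, ← mul_assoc _ _ z, he, one_mul]
  · rw [sign_pos h]
    exact exists_hasSign_one hφ hψ h

theorem IsCentered.of_mem_star {Δ : ℤ[X] →ₐ[ℤ] ℤ[X] ⊗[ℤ] ℤ[X]} {a b c : ℝ}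
    (hΔ : ∀ x, evalPair a b (Δ x) = aeval c x) {φ ψ χ : D} (hφ : IsCentered a φ)
    (hψ : IsCentered b ψ) (hχ : χ ∈ star Δ φ ψ) : IsCentered c χ := by
  intro x hx
  obtain ⟨k, hk, h⟩ := exists_hasSign_one hφ hψ (z := Δ x) (by rwa [hΔ])
  have := mem_signAdd_of_hasSign hχ (x := ((k + k : ℕ) : ℤ[X]) * x) h h
    (by rw [map_mul, map_natCast]; push_cast; ring)
  rw [χ.map_natCast_mul (by omega)] at this
  exact ((mem_signAdd _ _ _).1 this).2.2 rfl

theorem differentiable_evalPair_left (b : ℝ) (z : ℤ[X] ⊗[ℤ] ℤ[X]) :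
    Differentiable ℝ fun a => evalPair a b z := by
  induction z using TensorProduct.induction_on with
  | zero => simp
  | add x y hx hy => simp only [map_add]; exact hx.add hy
  | tmul f g => simpa using f.differentiable_aeval.mul_const _

theorem differentiable_evalPair_right (a : ℝ) (z : ℤ[X] ⊗[ℤ] ℤ[X]) :
    Differentiable ℝ fun b => evalPair a b z := by
  induction z using TensorProduct.induction_on with
  | zero => simp
  | add x y hx hy => simp only [map_add]; exact hx.add hy
  | tmul f g => simpa using g.differentiable_aeval.const_mul _

theorem aeval_derivative_mul_eq {F h : ℝ → ℝ} {x p : ℤ[X]} {a c : ℝ} (hF : HasDerivAt F c a)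
    (hh : DifferentiableAt ℝ h a) (hp : aeval a p = 0)
    (heq : ∀ y, aeval (F y) x = aeval y p * h y) :
    aeval (F a) (derivative x) * c = aeval a (derivative p) * h a := by
  have h1 : HasDerivAt (fun y => aeval (F y) x) (aeval (F a) (derivative x) * c) a :=
    (x.hasDerivAt_aeval (F a)).comp a hF
  have h2 : HasDerivAt (fun y => aeval y p * h y) _ a :=
    (p.hasDerivAt_aeval a).mul hh.hasDerivAt
  rw [hp, zero_mul, add_zero] at h2
  rw [← funext heq] at h2
  exact h1.unique h2

theorem mem_signAdd_of_germ_mem_star {Δ : ℤ[X] →ₐ[ℤ] ℤ[X] ⊗[ℤ] ℤ[X]} {F : ℝ → ℝ → ℝ}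
    (hΔ : ∀ a b x, evalPair a b (Δ x) = aeval (F a b) x) {a b c d : ℝ} (ha : IsAlgebraic ℚ a)
    (hb : IsAlgebraic ℚ b) (hc : HasDerivAt (fun y => F y b) c a)
    (hd : HasDerivAt (fun y => F a y) d b) (hc0 : c ≠ 0) (hd0 : d ≠ 0) {s t u : SignType}
    (h : germ (F a b) u ∈ star Δ (germ a s) (germ b t)) :
    u ∈ signAdd (s * SignType.sign c) (t * SignType.sign d) := by
  obtain ⟨p, hpsq, hp, -⟩ := exists_squarefree_generator ha
  obtain ⟨q, hqsq, hq, -⟩ := exists_squarefree_generator hb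
  obtain ⟨x, A, B, hxsq, hx⟩ := exists_squarefree_aeval_eq_add hpsq hqsq Δ
  have hF : ∀ y z, aeval (F y z) x =
      aeval y p * evalPair y z A + aeval z q * evalPair y z B := by
    intro y z
    rw [← hΔ, hx]
    simp
  have hx0 : aeval (F a b) x = 0 := by rw [hF, hp, hq]; ring
  have hx' := aeval_derivative_ne_zero_of_squarefree hxsq hx0
  have hp' := aeval_derivative_ne_zero_of_squarefree hpsq hp
  have hq' := aeval_derivative_ne_zero_of_squarefree hqsq hq
  have hA := aeval_derivative_mul_eq hc (differentiable_evalPair_left b A a) hp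
    (fun y => by rw [hF, hq]; ring)
  have hB := aeval_derivative_mul_eq hd (differentiable_evalPair_right a B b) hq
    (fun y => by rw [hF, hp]; ring)
  have hA0 : evalPair a b A ≠ 0 := fun h0 => by
    rw [h0, mul_zero] at hA
    exact mul_ne_zero hx' hc0 hA
  have hB0 : evalPair a b B ≠ 0 := fun h0 => by
    rw [h0, mul_zero] at hB
    exact mul_ne_zero hx' hd0 hB
  obtain ⟨k, hk, hkA⟩ := exists_hasSign (isCentered_germ a s) (isCentered_germ b t) hA0
  obtain ⟨m, hm, hmB⟩ := exists_hasSign (isCentered_germ a s) (isCentered_germ b t) hB0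
  have key := mem_signAdd_of_hasSign h (x := ((k * m : ℕ) : ℤ[X]) * x)
    ((hkA.tmul_mul p 1).natCast_mul hm) ((hmB.tmul_mul 1 q).natCast_mul hk)
    (by rw [map_mul, map_natCast, hx]; push_cast; ring)
  rw [HyperHom.map_natCast_mul _ (Nat.mul_pos hk hm), germ_of_simple_root _ hx0 hx',
    germ_of_simple_root _ hp hp', germ_of_simple_root _ hq hq', HyperHom.map_one,
    HyperHom.map_one, mul_one, one_mul, mul_assoc s, mul_assoc t, ← sign_mul, ← sign_mul, ← hA,
    ← hB, sign_mul, sign_mul] at key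
  have hτ := sign_ne_zero.2 hx'
  clear h hkA hmB
  revert key hτ
  generalize SignType.sign (aeval (F a b) (derivative x)) = τ, SignType.sign c = σ,
    SignType.sign d = ρ
  revert s t u τ σ ρ
  decide

theorem exists_sign_add_eq {s t u : SignType} (h : u ∈ signAdd s t) :
    ∃ c d : ℝ, 0 < c ∧ 0 < d ∧ SignType.sign (s * c + t * d) = u := by
  have key : ∃ c ∈ ({1, 2} : Finset ℤ), ∃ d ∈ ({1, 2} : Finset ℤ),
      SignType.sign ((s : ℤ) * c + t * d) = u := by
    revert s t u; decide
  obtain ⟨c, hc, d, hd, h⟩ := key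
  have hpos : ∀ e ∈ ({1, 2} : Finset ℤ), 0 < e := by decide
  refine ⟨c, d, by exact_mod_cast hpos c hc, by exact_mod_cast hpos d hd, ?_⟩
  rw [← h, ← sign_intCast (α := ℝ)]
  push_cast
  simp

theorem sign_add_mul_of_pos (x y c d : ℝ) {ε : ℝ} (hε : 0 < ε) :
    SignType.sign (x * (c * ε) + y * (d * ε)) = SignType.sign (x * c + y * d) := by
  rw [← mul_assoc, ← mul_assoc, ← add_mul, sign_mul, sign_pos hε, mul_one]

end Star

open Polynomial Filter Topology

/-! ### The additive structure -/

theorem evalPair_deltaAdd (a b : ℝ) (x : ℤ[X]) :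
    evalPair a b (deltaAdd x) = aeval (a + b) x := by
  rw [deltaAdd, ← aeval_algHom_apply]
  simp

theorem tendsto_path {γ : ℝ → ℝ} (hγ : Continuous γ) {r : ℝ} (h0 : γ 0 = r) {s : SignType}
    (hs : ∀ ε > 0, SignType.sign (γ ε - r) = s) : Tendsto γ (𝓝[>] 0) (side r s) := by
  refine tendsto_side (h0 ▸ (hγ.tendsto 0).mono_left nhdsWithin_le_nhds) ?_
  filter_upwards [self_mem_nhdsWithin] with ε hε using hs ε hε

theorem germ_add_mem_star {a b : ℝ} {s t u : SignType} (h : u ∈ signAdd s t) :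
    germ (a + b) u ∈ star deltaAdd (germ a s) (germ b t) := by
  obtain ⟨c, d, hc, hd, hu⟩ := exists_sign_add_eq h
  refine germ_mem_star (F := (· + ·)) evalPair_deltaAdd (l := 𝓝[>] (0 : ℝ))
    (α := fun ε => a + s * (c * ε)) (β := fun ε => b + t * (d * ε))
    (tendsto_path (by fun_prop) (by simp) fun ε hε => ?_)
    (tendsto_path (by fun_prop) (by simp) fun ε hε => ?_)
    (tendsto_path (by fun_prop) (by simp) fun ε hε => ?_)
  · rw [add_sub_cancel_left, sign_coe_mul s (mul_pos hc hε)]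
  · rw [add_sub_cancel_left, sign_coe_mul t (mul_pos hd hε)]
  · rw [add_add_add_comm, add_sub_cancel_left, sign_add_mul_of_pos _ _ _ _ hε, hu]

theorem exists_of_mem_star_deltaAdd {a b : ℝ} {s t : SignType} {φ : D}
    (h : φ ∈ star deltaAdd (germ a s) (germ b t)) :
    ∃ u, φ = germ (a + b) u ∧ (IsAlgebraic ℚ a → IsAlgebraic ℚ b → u ∈ signAdd s t) := by
  obtain ⟨u, rfl⟩ := ((isCentered_germ a s).of_mem_star (evalPair_deltaAdd a b)
    (isCentered_germ b t) h).exists_eq_germ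
  refine ⟨u, rfl, fun ha hb => ?_⟩
  have := mem_signAdd_of_germ_mem_star (F := (· + ·)) evalPair_deltaAdd ha hb
    ((hasDerivAt_id a).add_const b) ((hasDerivAt_id b).const_add a) one_ne_zero one_ne_zero h
  simpa using this

theorem isStable_deltaAdd : IsStable (star deltaAdd) DFinite := by
  intro φ hφ ψ hψ χ hχ
  obtain ⟨a, s, rfl⟩ := mem_DFinite_iff_germ.1 hφ
  obtain ⟨b, t, rfl⟩ := mem_DFinite_iff_germ.1 hψ
  obtain ⟨u, rfl, -⟩ := exists_of_mem_star_deltaAdd hχ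
  exact germ_mem_DFinite _ _

theorem deltaAdd_hypergroup :
    (∃ e, IsCanonicalHypergroup (restrictOp (star deltaAdd) DFinite) e) ∧
      HyperIsomorphic (restrictOp (star deltaAdd) DFinite) realSignAdd := by
  refine isCanonicalHypergroup_and_isomorphic_of_parametrization realAlgebraic _
    (fun x => ⟨germ x.1 x.2, germ_mem_DFinite _ _⟩) ?_ ?_ ?_ ?_
  · rintro ⟨φ, hφ⟩
    obtain ⟨a, s, rfl⟩ := mem_DFinite_iff_germ.1 hφ
    exact ⟨(a, s), rfl⟩
  · intro x y
    rw [Subtype.mk.injEq]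
    exact germ_eq_germ
  · rintro x y ⟨c, u⟩ ⟨hc, hu⟩
    obtain rfl : c = x.1 + y.1 := hc
    exact germ_add_mem_star hu
  · rintro a b s t ⟨φ, hφ⟩ h
    obtain ⟨u, rfl, hu⟩ := exists_of_mem_star_deltaAdd h
    exact ⟨u, rfl, hu⟩

/-! ### The multiplicative structure -/

theorem evalPair_deltaMul (a b : ℝ) (x : ℤ[X]) :
    evalPair a b (deltaMul x) = aeval (a * b) x := by
  rw [deltaMul, ← aeval_algHom_apply]
  simp

theorem sign_exp_sub_one (x : ℝ) : SignType.sign (Real.exp x - 1) = SignType.sign x := by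
  rcases lt_trichotomy x 0 with h | rfl | h
  · rw [sign_neg h, sign_neg (sub_neg.2 (Real.exp_lt_one_iff.2 h))]
  · simp
  · rw [sign_pos h, sign_pos (sub_pos.2 (Real.one_lt_exp_iff.2 h))]

theorem sign_mul_exp_sub (a x : ℝ) :
    SignType.sign (a * Real.exp x - a) = SignType.sign a * SignType.sign x := by
  rw [← mul_sub_one, sign_mul, sign_exp_sub_one]

theorem germ_mul_mem_star {a b : ℝ} {s t u : SignType} (h : u ∈ signAdd s t) :
    germ (a * b) (SignType.sign (a * b) * u) ∈
      star deltaMul (germ a (SignType.sign a * s)) (germ b (SignType.sign b * t)) := by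
  obtain ⟨c, d, hc, hd, hu⟩ := exists_sign_add_eq h
  refine germ_mem_star (F := (· * ·)) evalPair_deltaMul (l := 𝓝[>] (0 : ℝ))
    (α := fun ε => a * Real.exp (s * (c * ε))) (β := fun ε => b * Real.exp (t * (d * ε)))
    (tendsto_path (by fun_prop) (by simp) fun ε hε => ?_)
    (tendsto_path (by fun_prop) (by simp) fun ε hε => ?_)
    (tendsto_path (by fun_prop) (by simp) fun ε hε => ?_)
  · rw [sign_mul_exp_sub, sign_coe_mul s (mul_pos hc hε)]
  · rw [sign_mul_exp_sub, sign_coe_mul t (mul_pos hd hε)]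
  · rw [mul_mul_mul_comm, ← Real.exp_add, sign_mul_exp_sub,
      sign_add_mul_of_pos _ _ _ _ hε, hu]

theorem exists_of_mem_star_deltaMul {a b : ℝ} (ha0 : a ≠ 0) (hb0 : b ≠ 0) {s t : SignType} {φ : D}
    (h : φ ∈ star deltaMul (germ a (SignType.sign a * s)) (germ b (SignType.sign b * t))) :
    ∃ u, φ = germ (a * b) (SignType.sign (a * b) * u) ∧
      (IsAlgebraic ℚ a → IsAlgebraic ℚ b → u ∈ signAdd s t) := by
  obtain ⟨u, rfl⟩ := ((isCentered_germ a _).of_mem_star (evalPair_deltaMul a b)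
    (isCentered_germ b _) h).exists_eq_germ
  have hab : SignType.sign (a * b) * SignType.sign (a * b) = 1 := by
    rw [← sign_mul, sign_pos (mul_self_pos.2 (mul_ne_zero ha0 hb0))]
  refine ⟨SignType.sign (a * b) * u, by rw [← mul_assoc, hab, one_mul], fun ha hb => ?_⟩
  have key := mem_signAdd_of_germ_mem_star (F := (· * ·)) evalPair_deltaMul ha hb
    (hasDerivAt_mul_const b) (hasDerivAt_const_mul a) hb0 ha0 h
  have h1 := sign_ne_zero.2 ha0
  have h2 := sign_ne_zero.2 hb0
  rw [sign_mul]
  clear h hab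
  revert key h1 h2
  generalize SignType.sign a = σ, SignType.sign b = τ
  revert s t u σ τ
  decide

theorem mem_DFiniteNonzero {φ : D} :
    φ ∈ DFiniteNonzero ↔ ∃ (a : ℝˣ) (s : SignType), φ = germ a (SignType.sign (a : ℝ) * s) := by
  have hre : ∀ a s, Re (germ a s) = a := fun a s => (isCentered_germ a s).re_eq
  constructor
  · rintro ⟨h, h0⟩
    obtain ⟨a, s, rfl⟩ := mem_DFinite_iff_germ.1 h
    rw [hre] at h0
    have ha : a ≠ 0 := by exact_mod_cast h0
    refine ⟨Units.mk0 a ha, SignType.sign a * s, ?_⟩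
    rw [Units.val_mk0, ← mul_assoc, ← sign_mul, sign_pos (mul_self_pos.2 ha), one_mul]
  · rintro ⟨a, s, rfl⟩
    refine ⟨germ_mem_DFinite _ _, ?_⟩
    rw [hre]
    exact_mod_cast a.ne_zero

theorem isStable_deltaMul : IsStable (star deltaMul) DFiniteNonzero := by
  intro φ hφ ψ hψ χ hχ
  obtain ⟨a, s, rfl⟩ := mem_DFiniteNonzero.1 hφ
  obtain ⟨b, t, rfl⟩ := mem_DFiniteNonzero.1 hψ
  obtain ⟨u, rfl, -⟩ := exists_of_mem_star_deltaMul a.ne_zero b.ne_zero hχ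
  exact mem_DFiniteNonzero.2 ⟨a * b, u, by rw [Units.val_mul]⟩

theorem deltaMul_hypergroup :
    (∃ e, IsCanonicalHypergroup (restrictOp (star deltaMul) DFiniteNonzero) e) ∧
      HyperIsomorphic (restrictOp (star deltaMul) DFiniteNonzero) realUnitsSignAdd := by
  refine isCanonicalHypergroup_and_isomorphic_of_parametrization
    (Subgroup.toAddSubgroup realAlgebraicUnits) _
    (fun x => ⟨germ (x.1.toMul : ℝ) (SignType.sign (x.1.toMul : ℝ) * x.2),
      mem_DFiniteNonzero.2 ⟨_, _, rfl⟩⟩) ?_ ?_ ?_ ?_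
  · rintro ⟨φ, hφ⟩
    obtain ⟨a, s, rfl⟩ := mem_DFiniteNonzero.1 hφ
    exact ⟨(Additive.ofMul a, s), rfl⟩
  · rintro ⟨x, s⟩ ⟨y, t⟩
    rw [Subtype.mk.injEq, germ_eq_germ]
    constructor
    · rintro ⟨h1, h2⟩
      obtain rfl : x = y := Additive.toMul.injective (Units.ext h1)
      exact ⟨rfl, fun hx => mul_left_cancel₀ (sign_ne_zero.2 x.toMul.ne_zero) (h2 hx)⟩
    · rintro ⟨h1, h2⟩
      obtain rfl : x = y := h1
      exact ⟨rfl, fun hx => congrArg _ (h2 hx)⟩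
  · rintro x y ⟨c, u⟩ ⟨hc, hu⟩
    obtain rfl : c = x.1 + y.1 := hc
    exact germ_mul_mem_star hu
  · rintro a b s t ⟨φ, hφ⟩ h
    obtain ⟨u, rfl, hu⟩ := exists_of_mem_star_deltaMul a.toMul.ne_zero b.toMul.ne_zero h
    exact ⟨u, rfl, hu⟩

end HyperSign

theorem mainTheorem8 :
    (HyperSign.IsStable (HyperSign.star HyperSign.deltaAdd) HyperSign.DFinite ∧
      (∃ e, HyperSign.IsCanonicalHypergroup
        (HyperSign.restrictOp (HyperSign.star HyperSign.deltaAdd) HyperSign.DFinite) e) ∧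
      HyperSign.HyperIsomorphic
        (HyperSign.restrictOp (HyperSign.star HyperSign.deltaAdd) HyperSign.DFinite)
        HyperSign.realSignAdd) ∧
    (HyperSign.IsStable (HyperSign.star HyperSign.deltaMul) HyperSign.DFiniteNonzero ∧
      (∃ e, HyperSign.IsCanonicalHypergroup
        (HyperSign.restrictOp (HyperSign.star HyperSign.deltaMul) HyperSign.DFiniteNonzero) e) ∧
      HyperSign.HyperIsomorphic
        (HyperSign.restrictOp (HyperSign.star HyperSign.deltaMul) HyperSign.DFiniteNonzero)
        HyperSign.realUnitsSignAdd) :=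
  ⟨⟨HyperSign.isStable_deltaAdd, HyperSign.deltaAdd_hypergroup⟩,
    HyperSign.isStable_deltaMul, HyperSign.deltaMul_hypergroup⟩
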